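/- Let $p$ be a prime, $F$ a field of characteristic $p$, and $K/F$ a finite purely inseparable field extension of exponent one with $[K:F]=p^e$. Let $B$ be a $p$-algebra of degree $m$ over $F$ (a central simple $F$-algebra of dimension $m^2$ whose index is a power of $p$) which is split by $K$, and suppose $2\le m<p^e$. For a derivation $\delta$ of $K$ with field of constants $F$, let $K[t;\delta]$ be the differential polynomial ring (coefficients on the left, $ta=at+\delta(a)$ for $a\in K$). For $f\in K[t;\delta]$ of degree $m$, let $S_f=K[t;\delta]/K[t;\delta]f$ be the unital nonassociative $F$-algebra of all $g\in K[t;\delta]$ with $\deg g<m$, with multiplication $g\circ h=gh \bmod_r f$, the remainder of $gh$ under right division by $f$ (that is, $gh=qf+r$ with $\deg r<m$). With $[x,y,z]=(xy)z-x(yz)$, the left, middle and right nucleus of an algebra $A$ are the sets of $x\in A$ with $[x,A,A]=0$, $[A,x,A]=0$ and $[A,A,x]=0$, respectively, and the nucleus of $A$ is their intersection. $A\neq 0$ is a division algebra if left and right multiplication by every nonzero element are bijective. Then there are a derivation $\delta$ of $K$ with field of constants $F$, algebraic of degree $p^e$ with minimal polynomial of the form $t^{p^e}+c_1t^{p^{e-1}}+\dots+c_et\in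 F[t]$, and an $f\in K[t;\delta]$ of degree $m$, such that: (i) $S_f$ has dimension $mp^e$ over $F$; its right nucleus is isomorphic to $B$ as an $F$-algebra (and is identified with $B$ below); its left and its middle nucleus are $K$ (the constant polynomials); and its nucleus is $B\cap K$, an intermediate field of $K/F$ different from $K$. (ii) $f$ is irreducible if and only if $B$ is a division algebra, if and only if $S_f$ is a division algebra. (iii) Every $F$-algebra automorphism of $S_f$ restricts to an inner automorphism of $B$ and to an $F$-automorphism of $K$. -/

import Mathlib

open Polynomial
open scoped TensorProduct

universe u v w

/-! ### The differential polynomial ring `K[t;δ]` -/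

/-- The differential polynomial ring `K[t;δ]`: polynomials `a₀ + a₁ t + ⋯ + aₙ tⁿ` with coefficients
written on the left, added termwise, and multiplied by the rule `t a = a t + δ(a)`. The underlying
additive group is that of `K[X]`, with `X` in the role of `t`. -/
def DiffPoly {F : Type u} {K : Type v} [Field F] [Field K] [Algebra F K]
    (_δ : Derivation F K K) : Type v := K[X]

namespace DiffPoly

section

variable {F : Type u} {K : Type v} [Field F] [Field K] [Algebra F K] (δ : Derivation F K K)

noncomputable instance : AddCommGroup (DiffPoly δ) := inferInstanceAs (AddCommGroup K[X])
noncomputable instance : Module K (DiffPoly δ) := inferInstanceAs (Module K K[X])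
noncomputable instance : Module F (DiffPoly δ) := inferInstanceAs (Module F K[X])
instance : IsScalarTower F K (DiffPoly δ) := inferInstanceAs (IsScalarTower F K K[X])

/-- The map `∑ aᵢ Xⁱ ↦ ∑ δ(aᵢ) Xⁱ`. -/
noncomputable def coeffDeriv : K[X] →ₗ[F] K[X] :=
  Polynomial.lsum fun i => ((monomial i).restrictScalars F).comp δ.toLinearMap

/-- Left multiplication by `t` in `K[t;δ]`: the map `∑ aᵢ tⁱ ↦ ∑ (aᵢ tⁱ⁺¹ + δ(aᵢ) tⁱ)`. -/
noncomputable def tMul : K[X] →ₗ[F] K[X] := LinearMap.mulLeft F X + coeffDeriv δ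

/-- The product of `K[t;δ]`: `(∑ aᵢ tⁱ) g = ∑ aᵢ (t (t (⋯ (t g))))`, with `i` factors `t`. -/
noncomputable def mulPoly (f g : K[X]) : K[X] := f.sum fun i a => a • ((tMul δ ^ i) g)

theorem coeffDeriv_coeff (p : K[X]) (n : ℕ) : (coeffDeriv δ p).coeff n = δ (p.coeff n) := by
  induction p using Polynomial.induction_on' with
  | add p q hp hq => simp [hp, hq]
  | monomial i a =>
    rw [coeffDeriv, lsum_apply, Polynomial.sum_monomial_index _ _ (by simp)]
    by_cases h : i = n <;> simp [coeff_monomial, h]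

theorem coeffDeriv_smul (a : K) (p : K[X]) :
    coeffDeriv δ (a • p) = a • coeffDeriv δ p + δ a • p := by
  ext n
  simp only [coeffDeriv_coeff, coeff_smul, coeff_add, smul_eq_mul, Derivation.leibniz]
  ring

theorem tMul_apply (p : K[X]) : tMul δ p = X * p + coeffDeriv δ p := rfl

/-- The commutation rule `t a = a t + δ(a)`, applied to a polynomial. -/
theorem tMul_smul (a : K) (p : K[X]) : tMul δ (a • p) = a • tMul δ p + δ a • p := by
  simp only [tMul_apply, coeffDeriv_smul, smul_add, mul_smul_comm, add_assoc]

theorem mulPoly_monomial (i : ℕ) (a : K) (g : K[X]) :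
    mulPoly δ (monomial i a) g = a • ((tMul δ ^ i) g) := by
  rw [mulPoly, Polynomial.sum_monomial_index _ _ (by simp)]

theorem mulPoly_add_left (f g h : K[X]) :
    mulPoly δ (f + g) h = mulPoly δ f h + mulPoly δ g h := by
  rw [mulPoly, Polynomial.sum_add_index _ _ _ (by simp) (by intros; rw [add_smul])]
  rfl

theorem mulPoly_zero_left (h : K[X]) : mulPoly δ 0 h = 0 := by simp [mulPoly]

theorem mulPoly_add_right (f g h : K[X]) :
    mulPoly δ f (g + h) = mulPoly δ f g + mulPoly δ f h := by
  simp only [mulPoly, Polynomial.sum, map_add, smul_add, Finset.sum_add_distrib]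

theorem mulPoly_zero_right (f : K[X]) : mulPoly δ f 0 = 0 := by simp [mulPoly, Polynomial.sum]

theorem mulPoly_smul_left (a : K) (f g : K[X]) :
    mulPoly δ (a • f) g = a • mulPoly δ f g := by
  induction f using Polynomial.induction_on' with
  | add p q hp hq => rw [smul_add, mulPoly_add_left, mulPoly_add_left, hp, hq, smul_add]
  | monomial i b => rw [smul_monomial, mulPoly_monomial, mulPoly_monomial, smul_eq_mul, mul_smul]

theorem mulPoly_tMul_left (g h : K[X]) :
    mulPoly δ (tMul δ g) h = tMul δ (mulPoly δ g h) := by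
  induction g using Polynomial.induction_on' with
  | add p q hp hq => simp only [map_add, mulPoly_add_left, hp, hq]
  | monomial i a =>
    have hm : tMul δ (monomial i a) = monomial (i + 1) a + monomial i (δ a) := by
      rw [tMul_apply, X_mul_monomial]
      congr 1
      ext n
      rw [coeffDeriv_coeff]
      by_cases h : i = n <;> simp [coeff_monomial, h]
    rw [hm, mulPoly_add_left, mulPoly_monomial, mulPoly_monomial, mulPoly_monomial, tMul_smul,
      pow_succ', Module.End.mul_apply]

theorem mulPoly_assoc (f g h : K[X]) :
    mulPoly δ (mulPoly δ f g) h = mulPoly δ f (mulPoly δ g h) := by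
  induction f using Polynomial.induction_on' with
  | add p q hp hq => simp only [mulPoly_add_left, hp, hq]
  | monomial i a =>
    rw [mulPoly_monomial, mulPoly_monomial, mulPoly_smul_left]
    congr 1
    induction i with
    | zero => simp
    | succ i ih => rw [pow_succ', Module.End.mul_apply, mulPoly_tMul_left, ih, Module.End.mul_apply]

theorem tMul_pow_one (i : ℕ) : (tMul δ ^ i) (1 : K[X]) = X ^ i := by
  induction i with
  | zero => simp
  | succ i ih =>
    have h : coeffDeriv δ (X ^ i : K[X]) = 0 := by
      ext n
      rw [coeffDeriv_coeff, coeff_X_pow]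
      split_ifs <;> simp
    rw [pow_succ', Module.End.mul_apply, ih, tMul_apply, h, add_zero, ← pow_succ']

theorem mulPoly_one (f : K[X]) : mulPoly δ f 1 = f := by
  induction f using Polynomial.induction_on' with
  | add p q hp hq => simp only [mulPoly_add_left, hp, hq]
  | monomial i a =>
    rw [mulPoly_monomial, tMul_pow_one, smul_X_eq_monomial]

theorem one_mulPoly (f : K[X]) : mulPoly δ 1 f = f := by
  rw [← monomial_zero_one, mulPoly_monomial, pow_zero, Module.End.one_apply, one_smul]

noncomputable instance : Ring (DiffPoly δ) where
  mul f g := mulPoly δ f g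
  one := (1 : K[X])
  left_distrib := mulPoly_add_right δ
  right_distrib := mulPoly_add_left δ
  zero_mul := mulPoly_zero_left δ
  mul_zero := mulPoly_zero_right δ
  mul_assoc := mulPoly_assoc δ
  one_mul := one_mulPoly δ
  mul_one := mulPoly_one δ
  zsmul := fun n f => n • f
  zsmul_zero' := SubNegMonoid.zsmul_zero'
  zsmul_succ' := SubNegMonoid.zsmul_succ'
  zsmul_neg' := SubNegMonoid.zsmul_neg'
  nsmul := fun n f => n • f
  nsmul_zero := AddMonoid.nsmul_zero
  nsmul_succ := AddMonoid.nsmul_succ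
  neg_add_cancel := neg_add_cancel
  add_comm := add_comm
  sub_eq_add_neg := sub_eq_add_neg

/-- The degree of a differential polynomial, with the convention that it is `0` for `0`. -/
noncomputable def natDegree {δ : Derivation F K K} (f : DiffPoly δ) : ℕ :=
  Polynomial.natDegree (R := K) f

theorem mulPoly_smul_right (c : F) (f g : K[X]) :
    mulPoly δ f (c • g) = c • mulPoly δ f g := by
  simp only [mulPoly, Polynomial.sum, map_smul, Finset.smul_sum]
  exact Finset.sum_congr rfl fun i _ => smul_comm _ _ _

theorem smul_mul' {δ : Derivation F K K} (a : K) (f g : DiffPoly δ) :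
    (a • f) * g = a • (f * g) :=
  mulPoly_smul_left δ a f g

theorem mul_smul' {δ : Derivation F K K} (c : F) (f g : DiffPoly δ) :
    f * (c • g) = c • (f * g) :=
  mulPoly_smul_right δ c f g

theorem tMul_pow_coeff (p : K[X]) (N : ℕ) (hp : ∀ k, N < k → p.coeff k = 0) (i : ℕ) :
    (∀ k, N + i < k → ((tMul δ ^ i) p).coeff k = 0) ∧
      ((tMul δ ^ i) p).coeff (N + i) = p.coeff N := by
  induction i with
  | zero => exact ⟨by simpa using hp, by simp⟩
  | succ i ih =>
    have hs : ∀ k, ((tMul δ ^ (i + 1)) p).coeff (k + 1) =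
        ((tMul δ ^ i) p).coeff k + δ (((tMul δ ^ i) p).coeff (k + 1)) := by
      intro k
      rw [pow_succ', Module.End.mul_apply, tMul_apply, coeff_add, coeff_X_mul, coeffDeriv_coeff]
    refine ⟨fun k hk => ?_, ?_⟩
    · obtain ⟨k, rfl⟩ : ∃ j, k = j + 1 := ⟨k - 1, by omega⟩
      rw [hs, ih.1 k (by omega), ih.1 (k + 1) (by omega), map_zero, add_zero]
    · rw [← add_assoc, hs, ih.2, ih.1 (N + i + 1) (by omega), map_zero, add_zero]

theorem mulPoly_coeff_top (q f : K[X]) :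
    (mulPoly δ q f).coeff (f.natDegree + q.natDegree) = q.leadingCoeff * f.leadingCoeff := by
  have h := tMul_pow_coeff δ f f.natDegree fun k hk => coeff_eq_zero_of_natDegree_lt hk
  rw [mulPoly, Polynomial.sum, finsetSum_coeff, Finset.sum_eq_single q.natDegree]
  · rw [coeff_smul, (h _).2, smul_eq_mul]; rfl
  · intro i hi hne
    have hi' : i ≤ q.natDegree := le_natDegree_of_mem_supp i hi
    rw [coeff_smul, (h i).1 _ (by omega), smul_zero]
  · intro hq
    rw [notMem_support_iff.mp hq, zero_smul, coeff_zero]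

/-- Right division with remainder: `g = q f + r` with `deg r < deg f`. -/
theorem exists_right_div (f : K[X]) (hf : f ≠ 0) (g : K[X]) :
    ∃ q r : K[X], g = mulPoly δ q f + r ∧ r.degree < f.natDegree := by
  have key : ∀ n : ℕ, ∀ g : K[X], g.degree < n →
      ∃ q r : K[X], g = mulPoly δ q f + r ∧ r.degree < f.natDegree := by
    intro n
    induction n with
    | zero =>
      intro g hg
      exact ⟨0, g, by rw [mulPoly_zero_left, zero_add], lt_of_lt_of_le hg (by simp)⟩
    | succ n ih =>
      intro g hg
      by_cases hn : n < f.natDegree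
      · exact ⟨0, g, by rw [mulPoly_zero_left, zero_add],
          lt_of_lt_of_le hg (by exact_mod_cast hn)⟩
      · have h := tMul_pow_coeff δ f f.natDegree
          (fun k hk => coeff_eq_zero_of_natDegree_lt hk) (n - f.natDegree)
        rw [show f.natDegree + (n - f.natDegree) = n by omega] at h
        set a : K := g.coeff n / f.leadingCoeff with ha
        have hlt : (g - mulPoly δ (monomial (n - f.natDegree) a) f).degree < n := by
          rw [degree_lt_iff_coeff_zero]
          intro k hk
          rw [coeff_sub, mulPoly_monomial, coeff_smul]
          rcases hk.eq_or_lt with rfl | hk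
          · rw [h.2, coeff_natDegree, ha, smul_eq_mul,
              div_mul_cancel₀ _ (leadingCoeff_ne_zero.mpr hf), sub_self]
          · rw [h.1 k hk, smul_zero, sub_zero]
            exact (degree_lt_iff_coeff_zero _ _).mp hg k hk
        obtain ⟨q, r, hq, hr⟩ := ih _ hlt
        refine ⟨monomial (n - f.natDegree) a + q, r, ?_, hr⟩
        rw [mulPoly_add_left, add_assoc, ← hq, add_sub_cancel]
  exact key (g.natDegree + 1) g
    (lt_of_le_of_lt degree_le_natDegree (by exact_mod_cast Nat.lt_succ_self _))

theorem right_div_unique (f : K[X]) (hf : f ≠ 0) (q r : K[X]) (h : mulPoly δ q f + r = 0)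
    (hr : r.degree < f.natDegree) : r = 0 := by
  by_cases hq : q = 0
  · simpa [hq, mulPoly_zero_left] using h
  · have h1 := mulPoly_coeff_top δ q f
    have h2 : r.coeff (f.natDegree + q.natDegree) = 0 :=
      (degree_lt_iff_coeff_zero _ _).mp hr _ (by omega)
    have h3 := congrArg (fun s => Polynomial.coeff s (f.natDegree + q.natDegree)) h
    simp only [coeff_add, h1, h2, add_zero, coeff_zero, mul_eq_zero, leadingCoeff_eq_zero] at h3
    tauto

/-- The remainder of the right division of `g` by `f`: the `r` with `deg r < deg f` and
`g = q f + r` for some `q`. (By convention it is `0` if `f = 0`.) -/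
noncomputable def modR {δ : Derivation F K K} (f g : DiffPoly δ) :
    Polynomial.degreeLT K f.natDegree :=
  open Classical in
  if hf : f = 0 then 0 else
    ⟨(exists_right_div δ f hf g).choose_spec.choose,
      Polynomial.mem_degreeLT.mpr (exists_right_div δ f hf g).choose_spec.choose_spec.2⟩

variable {δ}

/-- A polynomial of degree less than `deg f`, as an element of `K[t;δ]`. -/
def ofLT {f : DiffPoly δ} (r : Polynomial.degreeLT K f.natDegree) : DiffPoly δ := (r : K[X])

theorem modR_spec {f : DiffPoly δ} (hf : f ≠ 0) (g : DiffPoly δ) :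
    ∃ q : DiffPoly δ, g = q * f + ofLT (modR f g) := by
  refine ⟨(exists_right_div δ f hf g).choose, ?_⟩
  rw [modR, dif_neg hf]
  exact (exists_right_div δ f hf g).choose_spec.choose_spec.1

theorem modR_eq {f : DiffPoly δ} (hf : f ≠ 0) {g q : DiffPoly δ}
    {r : Polynomial.degreeLT K f.natDegree} (h : g = q * f + ofLT r) : modR f g = r := by
  obtain ⟨q', h'⟩ := modR_spec hf g
  have h0 : (q' - q) * f + ofLT (modR f g - r) = 0 := by
    have : ofLT (modR f g - r) = ofLT (modR f g) - ofLT r := rfl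
    rw [this, sub_mul, sub_add_sub_comm, ← h, ← h', sub_self]
  have := right_div_unique δ f hf _ _ h0 (Polynomial.mem_degreeLT.mp (modR f g - r).2)
  exact sub_eq_zero.mp (Subtype.ext this)

theorem modR_zero_left (g : DiffPoly δ) : modR (0 : DiffPoly δ) g = 0 := by
  rw [modR, dif_pos rfl]

theorem modR_add (f g h : DiffPoly δ) : modR f (g + h) = modR f g + modR f h := by
  by_cases hf : f = 0
  · subst hf; simp only [modR_zero_left, add_zero]
  obtain ⟨q, hq⟩ := modR_spec hf g
  obtain ⟨q', hq'⟩ := modR_spec hf h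
  refine modR_eq hf (q := q + q') ?_
  have : ofLT (modR f g + modR f h) = ofLT (modR f g) + ofLT (modR f h) := rfl
  rw [this, add_mul, add_add_add_comm, ← hq, ← hq']

theorem modR_smul (f : DiffPoly δ) (a : K) (g : DiffPoly δ) :
    modR f (a • g) = a • modR f g := by
  by_cases hf : f = 0
  · subst hf; simp only [modR_zero_left, smul_zero]
  obtain ⟨q, hq⟩ := modR_spec hf g
  refine modR_eq hf (q := a • q) ?_
  have : ofLT (a • modR f g) = a • ofLT (modR f g) := rfl
  rw [this, smul_mul', ← smul_add, ← hq]

theorem modR_ofLT {f : DiffPoly δ} (r : Polynomial.degreeLT K f.natDegree) :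
    modR f (ofLT r) = r := by
  by_cases hf : f = 0
  · subst hf
    refine Subtype.ext ?_
    rw [modR_zero_left]
    have h0 : natDegree (0 : DiffPoly δ) = 0 := Polynomial.natDegree_zero
    ext k
    exact ((degree_lt_iff_coeff_zero _ _).mp (Polynomial.mem_degreeLT.mp r.2) k
      (h0 ▸ Nat.zero_le k)).symm
  · exact modR_eq hf (q := 0) (by rw [zero_mul, zero_add])

end

end DiffPoly

/-! ### Petit algebras -/

/-- The Petit algebra `S_f = K[t;δ]/K[t;δ]f`: the vector space of differential polynomials of degree
less than `deg f`, with multiplication `g ∘ h = gh mod_r f`, the remainder of the right division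
of `gh` by `f`. -/
def PetitAlgebra {F : Type u} {K : Type v} [Field F] [Field K] [Algebra F K]
    {δ : Derivation F K K} (f : DiffPoly δ) : Type v := Polynomial.degreeLT K f.natDegree

namespace PetitAlgebra

section

variable {F : Type u} {K : Type v} [Field F] [Field K] [Algebra F K] {δ : Derivation F K K}
  (f : DiffPoly δ)

noncomputable instance : AddCommGroup (PetitAlgebra f) :=
  inferInstanceAs (AddCommGroup (Polynomial.degreeLT K f.natDegree))
noncomputable instance : Module K (PetitAlgebra f) :=
  inferInstanceAs (Module K (Polynomial.degreeLT K f.natDegree))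
noncomputable instance : Module F (PetitAlgebra f) :=
  inferInstanceAs (Module F (Polynomial.degreeLT K f.natDegree))
instance : IsScalarTower F K (PetitAlgebra f) :=
  inferInstanceAs (IsScalarTower F K (Polynomial.degreeLT K f.natDegree))

variable {f}

/-- The element of `K[t;δ]` underlying an element of `S_f`. -/
def toDiffPoly (x : PetitAlgebra f) : DiffPoly δ := DiffPoly.ofLT x

/-- The remainder modulo `f`, as an element of `S_f`. -/
noncomputable def red (g : DiffPoly δ) : PetitAlgebra f := DiffPoly.modR f g

theorem toDiffPoly_add (x y : PetitAlgebra f) :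
    toDiffPoly (x + y) = toDiffPoly x + toDiffPoly y := rfl
theorem toDiffPoly_zero : toDiffPoly (0 : PetitAlgebra f) = 0 := rfl
theorem toDiffPoly_smul (a : K) (x : PetitAlgebra f) :
    toDiffPoly (a • x) = a • toDiffPoly x := rfl
theorem toDiffPoly_smul' (c : F) (x : PetitAlgebra f) :
    toDiffPoly (c • x) = c • toDiffPoly x := rfl
theorem red_add (g h : DiffPoly δ) : (red (g + h) : PetitAlgebra f) = red g + red h :=
  DiffPoly.modR_add f g h
theorem red_smul (a : K) (g : DiffPoly δ) : (red (a • g) : PetitAlgebra f) = a • red g :=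
  DiffPoly.modR_smul f a g
theorem red_toDiffPoly (x : PetitAlgebra f) : red (toDiffPoly x) = x := DiffPoly.modR_ofLT x
theorem red_zero : (red 0 : PetitAlgebra f) = 0 := by
  rw [← toDiffPoly_zero (f := f), red_toDiffPoly]

/-- The unit of `S_f` is the constant polynomial `1`, provided that `f` has positive degree. -/
theorem toDiffPoly_red_one (hf : f.natDegree ≠ 0) :
    toDiffPoly (red 1 : PetitAlgebra f) = 1 := by
  have h : (1 : K[X]) ∈ Polynomial.degreeLT K f.natDegree := by
    rw [Polynomial.mem_degreeLT, Polynomial.degree_one]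
    exact_mod_cast Nat.pos_of_ne_zero hf
  obtain ⟨x, hx⟩ : ∃ x : PetitAlgebra f, toDiffPoly x = 1 := ⟨⟨1, h⟩, rfl⟩
  rw [← hx, red_toDiffPoly]

theorem eq_of_natDegree_eq_zero (hf : f.natDegree = 0) (x y : PetitAlgebra f) : x = y := by
  have h : ∀ z : PetitAlgebra f, z = 0 := by
    intro z
    refine Subtype.ext ?_
    ext k
    exact (degree_lt_iff_coeff_zero _ _).mp (Polynomial.mem_degreeLT.mp z.2) k
      (hf ▸ Nat.zero_le k)
  rw [h x, h y]

variable (f)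

noncomputable instance : NonAssocRing (PetitAlgebra f) where
  mul x y := red (toDiffPoly x * toDiffPoly y)
  one := red 1
  left_distrib x y z := by
    change red (_ * toDiffPoly (y + z)) = red _ + red _
    rw [toDiffPoly_add, mul_add, red_add]
  right_distrib x y z := by
    change red (toDiffPoly (x + y) * _) = red _ + red _
    rw [toDiffPoly_add, add_mul, red_add]
  zero_mul x := by
    change red (toDiffPoly 0 * _) = 0
    rw [toDiffPoly_zero, zero_mul, red_zero]
  mul_zero x := by
    change red (_ * toDiffPoly 0) = 0
    rw [toDiffPoly_zero, mul_zero, red_zero]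
  one_mul x := by
    by_cases hf : f.natDegree = 0
    · exact eq_of_natDegree_eq_zero hf _ _
    · change red (toDiffPoly (red 1) * toDiffPoly x) = x
      rw [toDiffPoly_red_one hf, one_mul, red_toDiffPoly]
  mul_one x := by
    by_cases hf : f.natDegree = 0
    · exact eq_of_natDegree_eq_zero hf _ _
    · change red (toDiffPoly x * toDiffPoly (red 1)) = x
      rw [toDiffPoly_red_one hf, mul_one, red_toDiffPoly]
  zsmul := fun n x => n • x
  zsmul_zero' := SubNegMonoid.zsmul_zero'
  zsmul_succ' := SubNegMonoid.zsmul_succ'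
  zsmul_neg' := SubNegMonoid.zsmul_neg'
  nsmul := fun n x => n • x
  nsmul_zero := AddMonoid.nsmul_zero
  nsmul_succ := AddMonoid.nsmul_succ
  neg_add_cancel := neg_add_cancel
  add_comm := add_comm
  sub_eq_add_neg := sub_eq_add_neg

theorem mul_def (x y : PetitAlgebra f) : x * y = red (toDiffPoly x * toDiffPoly y) := rfl

theorem smul_mul_left (a : K) (x y : PetitAlgebra f) : (a • x) * y = a • (x * y) := by
  rw [mul_def, mul_def, toDiffPoly_smul, DiffPoly.smul_mul', red_smul]

/-! The multiplication of `S_f` is bilinear over `F`. -/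

instance : IsScalarTower F (PetitAlgebra f) (PetitAlgebra f) where
  smul_assoc c x y := by
    rw [smul_eq_mul, smul_eq_mul, ← algebraMap_smul K c x, smul_mul_left, algebraMap_smul]

instance : SMulCommClass F (PetitAlgebra f) (PetitAlgebra f) where
  smul_comm c x y := by
    rw [smul_eq_mul, smul_eq_mul, mul_def, mul_def, toDiffPoly_smul', DiffPoly.mul_smul',
      ← algebraMap_smul K c (toDiffPoly x * _), red_smul, algebraMap_smul]

/-- The embedding of `K` into `S_f` as the constant polynomials, `a ↦ a · 1`. -/
noncomputable def const : K →+* PetitAlgebra f where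
  toFun a := a • 1
  map_one' := one_smul K 1
  map_mul' a b := by rw [smul_mul_left, one_mul, mul_smul]
  map_zero' := zero_smul K 1
  map_add' a b := add_smul a b 1

end

end PetitAlgebra

/-! ### Nonassociative algebras -/

section Nonassociative

variable (A : Type w)

/-- The left nucleus `{x | [x, A, A] = 0}`, where `[x, y, z] = (xy)z - x(yz)`. -/
def leftNucleus [NonUnitalNonAssocRing A] : Set A := {x | ∀ y z : A, associator x y z = 0}

/-- The middle nucleus `{x | [A, x, A] = 0}`. -/
def middleNucleus [NonUnitalNonAssocRing A] : Set A := {x | ∀ y z : A, associator y x z = 0}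

/-- The right nucleus `{x | [A, A, x] = 0}`. -/
def rightNucleus [NonUnitalNonAssocRing A] : Set A := {x | ∀ y z : A, associator y z x = 0}

/-- The nucleus, the intersection of the left, middle and right nuclei. -/
def nucleus [NonUnitalNonAssocRing A] : Set A :=
  leftNucleus A ∩ middleNucleus A ∩ rightNucleus A

/-- A (not necessarily associative) division algebra: `A ≠ 0`, and left and right multiplication
by every nonzero element are bijective. -/
def IsDivisionAlgebra [NonUnitalNonAssocRing A] : Prop :=
  Nontrivial A ∧ ∀ a : A, a ≠ 0 →
    Function.Bijective (fun x => a * x) ∧ Function.Bijective (fun x => x * a)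

end Nonassociative

/-! ### `p`-algebras and algebraic derivations -/

/-- `B` is a `p`-algebra of degree `m` over `F`, where `F` has characteristic `p`: a central simple
`F`-algebra of dimension `m²` whose index is a power of `p`. The index is the degree of the central
division algebra `D` with `B ≅ Mat_r(D)`. -/
structure IsPAlgebra (p : ℕ) (F : Type u) [Field F] (B : Type w) [Ring B] [Algebra F B]
    (m : ℕ) : Prop where
  isCentral : Algebra.IsCentral F B
  isSimple : IsSimpleRing B
  finrank_eq : 0 < m ∧ Module.finrank F B = m ^ 2
  index_eq : ∃ (n r : ℕ) (D : Type w) (_ : DivisionRing D) (_ : Algebra F D),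
    Nonempty (B ≃ₐ[F] Matrix (Fin r) (Fin r) D) ∧ Module.finrank F D = (p ^ n) ^ 2

/-- The field extension `K/F` splits `B`: `K ⊗_F B` is a full matrix algebra over `K`. -/
def IsSplitBy (F : Type u) [Field F] (B : Type w) [Ring B] [Algebra F B]
    (K : Type v) [Field K] [Algebra F K] : Prop :=
  ∃ n : ℕ, Nonempty (K ⊗[F] B ≃ₐ[K] Matrix (Fin n) (Fin n) K)

/-- `δ` is an algebraic derivation of `K` of degree `p ^ e` with field of constants `F`: its
constants are exactly the elements of `F`, and its minimal polynomial over `F` has the form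
`t^(p^e) + c₁ t^(p^(e-1)) + ⋯ + c_e t` (the coefficient of `t^(p^i)` being `c i` below). -/
structure IsAlgebraicDerivation (p e : ℕ) {F : Type u} {K : Type v} [Field F] [Field K]
    [Algebra F K] (δ : Derivation F K K) : Prop where
  constants : ∀ a : K, δ a = 0 → a ∈ (algebraMap F K).range
  minpoly_eq : ∃ c : Fin e → F, minpoly F (δ.toLinearMap : Module.End F K) =
    X ^ (p ^ e) + ∑ i : Fin e, C (c i) * X ^ (p ^ (i : ℕ))

/-! ### Degrees in `K[t;δ]` -/

namespace DiffPoly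

section

variable {F : Type u} {K : Type v} [Field F] [Field K] [Algebra F K] {δ : Derivation F K K}

/-! Write N = p^e. The plan is to realise `B` as the endomorphism ring of a cyclic module V over R =
K[t;δ] and to read S_f off that module.

The derivation: K is built from F by adjoining p-th roots one at a time. A nilpotent derivation of L
with constants F is never onto, so it extends to L(x) by sending x to some y outside its image; this
choice creates no new constants and keeps nilpotency (`Derivation.exists_extend`). The kernel of δ
is then a line, so δ has minimal polynomial X^N and 1, δ, …, δ^(N-1) are independent over K.
Consequently a two-sided ideal of R with a nonzero element of degree below N is all of R
(`one_mem_of_mem`).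

The module: on M_m(K), identified with K ⊗ B, the entrywise δ and the transported δ ⊗ 1 differ by a
K-linear derivation, which is inner, X ↦ PX - XP. On row vectors V = K^m, let t act as v ↦ δ(v) +
vP. The operators commuting with R are then the constants of δ ⊗ 1, that is, `B`
(`IsSplitBy.exists_diffBimodule`). The operator t^N lies in the centre of `B`, so it is a scalar d.
The image of R in the endomorphisms of V is therefore simple, of dimension at least N[K:F], and
since m ≤ N the module V is cyclic.

The algebra: let v generate V and let f have least degree among the nonzero elements killing v. Then
x ↦ xv identifies S_f with V, and (x ∘ y)v = x(yv). If deg x + deg y = deg f, the associator [x,y,z]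
is, up to a nonzero scalar, f(zv). Thus the right nucleus consists of the z with f(zv) = 0, which
are the R-endomorphisms of V; and since f does not kill V (m < N), no nonconstant x lies in the left
or middle nucleus. Factorisations of f correspond to submodules of V, which are direct summands and
hence given by idempotents of `B`. Automorphisms preserve associators, hence nuclei; Skolem–Noether
does the rest. -/

theorem mulPoly_coeff_eq_zero (q f : K[X]) {k : ℕ} (hk : f.natDegree + q.natDegree < k) :
    (mulPoly δ q f).coeff k = 0 := by
  have h := tMul_pow_coeff δ f f.natDegree fun k hk => coeff_eq_zero_of_natDegree_lt hk
  rw [mulPoly, Polynomial.sum, finsetSum_coeff]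
  refine Finset.sum_eq_zero fun i hi => ?_
  have hi' : i ≤ q.natDegree := le_natDegree_of_mem_supp i hi
  rw [coeff_smul, (h i).1 _ (by omega), smul_zero]

theorem natDegree_mulPoly {q f : K[X]} (hq : q ≠ 0) (hf : f ≠ 0) :
    (mulPoly δ q f).natDegree = q.natDegree + f.natDegree := by
  rw [add_comm]
  refine natDegree_eq_of_le_of_coeff_ne_zero ?_ ?_
  · exact natDegree_le_iff_coeff_eq_zero.mpr fun k hk => mulPoly_coeff_eq_zero q f hk
  · rw [mulPoly_coeff_top]
    exact mul_ne_zero (leadingCoeff_ne_zero.mpr hq) (leadingCoeff_ne_zero.mpr hf)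

theorem natDegree_mul {q f : DiffPoly δ} (hq : q ≠ 0) (hf : f ≠ 0) :
    (q * f).natDegree = q.natDegree + f.natDegree :=
  natDegree_mulPoly hq hf

variable (δ) in
/-- A polynomial, seen as an element of `K[t;δ]`. -/
def ofPoly (f : K[X]) : DiffPoly δ := f

/-- The coefficient polynomial of an element of `K[t;δ]`. -/
def poly (f : DiffPoly δ) : K[X] := f

theorem ofPoly_add (f g : K[X]) : ofPoly δ (f + g) = ofPoly δ f + ofPoly δ g := rfl
theorem ofPoly_sub (f g : K[X]) : ofPoly δ (f - g) = ofPoly δ f - ofPoly δ g := rfl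
theorem natDegree_ofPoly (f : K[X]) : (ofPoly δ f).natDegree = f.natDegree := rfl
theorem ofPoly_C_mul (a : K) (f : DiffPoly δ) : ofPoly δ (C a) * f = a • f := by
  change mulPoly δ (C a) (poly f) = a • poly f
  rw [← monomial_zero_left, mulPoly_monomial, pow_zero, Module.End.one_apply]

theorem ofPoly_C (a : K) : ofPoly δ (C a) = a • (1 : DiffPoly δ) := by
  rw [← mul_one (ofPoly δ (C a)), ofPoly_C_mul]

theorem natDegree_one : (1 : DiffPoly δ).natDegree = 0 := Polynomial.natDegree_one

theorem one_ne_zero' : (1 : DiffPoly δ) ≠ 0 := (one_ne_zero : (1 : K[X]) ≠ 0)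

theorem eq_smul_one_of_natDegree_eq_zero {f : DiffPoly δ} (hf : f.natDegree = 0) :
    f = (f.poly.coeff 0) • (1 : DiffPoly δ) := by
  rw [← ofPoly_C]
  exact Polynomial.eq_C_of_natDegree_eq_zero hf

theorem isUnit_iff {f : DiffPoly δ} : IsUnit f ↔ f ≠ 0 ∧ f.natDegree = 0 := by
  constructor
  · rintro ⟨u, rfl⟩
    have h1 : (u : DiffPoly δ) ≠ 0 := fun h => one_ne_zero' (δ := δ) (by
      rw [← u.mul_inv, h, zero_mul])
    have h2 : (↑u⁻¹ : DiffPoly δ) ≠ 0 := fun h => one_ne_zero' (δ := δ) (by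
      rw [← u.mul_inv, h, mul_zero])
    have h3 := natDegree_mul h1 h2
    rw [u.mul_inv, natDegree_one] at h3
    exact ⟨h1, by omega⟩
  · rintro ⟨h0, h1⟩
    obtain ⟨a, ha⟩ : ∃ a : K, f = ofPoly δ (C a) := ⟨_, Polynomial.eq_C_of_natDegree_eq_zero h1⟩
    have ha0 : a ≠ 0 := by
      rintro rfl
      exact h0 (by rw [ha, C_0]; rfl)
    rw [ha]
    refine ⟨⟨ofPoly δ (C a), ofPoly δ (C a⁻¹), ?_, ?_⟩, rfl⟩
    · rw [ofPoly_C_mul, ofPoly_C, smul_smul, mul_inv_cancel₀ ha0, one_smul]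
    · rw [ofPoly_C_mul, ofPoly_C, smul_smul, inv_mul_cancel₀ ha0, one_smul]

/-- Right division with remainder in `K[t;δ]`. -/
theorem exists_eq_mul_add {f : DiffPoly δ} (hf : f ≠ 0) (g : DiffPoly δ) :
    ∃ q r : DiffPoly δ, g = q * f + r ∧ (r.poly.degree < f.natDegree) :=
  exists_right_div δ f hf g

/-- Moving a scalar past t only creates terms of lower degree, and K is commutative, so fa and af
have the same top coefficient. This is the descent step for two-sided ideals and for annihilators.
-/
theorem natDegree_commutator_lt {f : DiffPoly δ} {a : K}
    (h : f * ofPoly δ (C a) - a • f ≠ 0) :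
    (f * ofPoly δ (C a) - a • f).natDegree < f.natDegree := by
  have ha : a ≠ 0 := by
    rintro rfl
    exact h (by rw [C_0, zero_smul, sub_zero]; exact mul_zero f)
  have key : ∀ k, f.natDegree ≤ k →
      (poly (f * ofPoly δ (C a) - a • f)).coeff k = 0 := by
    intro k hk
    change (mulPoly δ (poly f) (C a) - a • poly f).coeff k = 0
    rcases hk.eq_or_lt with rfl | hk
    · have := mulPoly_coeff_top δ (poly f) (C a)
      rw [natDegree_C, zero_add, leadingCoeff_C] at this
      rw [coeff_sub, coeff_smul, smul_eq_mul]
      change (mulPoly δ (poly f) (C a)).coeff (poly f).natDegree -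
        a * (poly f).coeff (poly f).natDegree = 0
      rw [this, mul_comm, coeff_natDegree, sub_self]
    · rw [coeff_sub, mulPoly_coeff_eq_zero _ _ (by rw [natDegree_C, zero_add]; exact hk),
        coeff_smul, coeff_eq_zero_of_natDegree_lt (show (poly f).natDegree < k from hk),
        smul_zero, sub_zero]
  by_contra! hle
  exact h (leadingCoeff_eq_zero.mp (key _ hle))

end

/-! ### Modules over `K[t;δ]` -/

section Action

variable {F : Type u} {K : Type v} [Field F] [Field K] [Algebra F K] {δ : Derivation F K K}
  {V : Type*} [AddCommGroup V] [Module F V] [Module K V] [IsScalarTower F K V]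

/-- The operator `∑ aᵢ Tⁱ` of an `F`-linear operator `T` on a `K`-vector space. -/
noncomputable def act (T : Module.End F V) (f : K[X]) : Module.End F V :=
  f.sum fun i a => a • T ^ i

theorem act_add (T : Module.End F V) (f g : K[X]) : act T (f + g) = act T f + act T g := by
  rw [act, Polynomial.sum_add_index _ _ _ (by simp) (by intros; rw [add_smul])]
  rfl

theorem act_monomial (T : Module.End F V) (i : ℕ) (a : K) :
    act T (monomial i a) = a • T ^ i := by
  rw [act, Polynomial.sum_monomial_index _ _ (by simp)]

theorem act_zero (T : Module.End F V) : act T (0 : K[X]) = 0 := by simp [act]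

theorem act_smul (T : Module.End F V) (a : K) (f : K[X]) : act T (a • f) = a • act T f := by
  induction f using Polynomial.induction_on' with
  | add p q hp hq => rw [smul_add, act_add, act_add, hp, hq, smul_add]
  | monomial i b => rw [smul_monomial, act_monomial, act_monomial, smul_eq_mul, mul_smul]

theorem act_tMul {T : Module.End F V} (hT : ∀ (a : K) v, T (a • v) = a • T v + δ a • v)
    (f : K[X]) : act T (tMul δ f) = T * act T f := by
  induction f using Polynomial.induction_on' with
  | add p q hp hq => rw [map_add, act_add, hp, hq, act_add, mul_add]
  | monomial i a =>
    have hm : tMul δ (monomial i a) = monomial (i + 1) a + monomial i (δ a) := by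
      rw [tMul_apply, X_mul_monomial]
      congr 1
      ext n
      rw [coeffDeriv_coeff]
      by_cases h : i = n <;> simp [coeff_monomial, h]
    rw [hm, act_add, act_monomial, act_monomial, act_monomial]
    ext v
    simp [hT, pow_succ']

theorem act_mulPoly {T : Module.End F V} (hT : ∀ (a : K) v, T (a • v) = a • T v + δ a • v)
    (f g : K[X]) : act T (mulPoly δ f g) = act T f * act T g := by
  induction f using Polynomial.induction_on' with
  | add p q hp hq => rw [mulPoly_add_left, act_add, act_add, hp, hq, add_mul]
  | monomial i a =>
    rw [mulPoly_monomial, act_smul, act_monomial, smul_mul_assoc]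
    congr 1
    induction i with
    | zero => simp
    | succ i ih => rw [pow_succ', Module.End.mul_apply, act_tMul hT, ih, pow_succ', mul_assoc]

/-- A `K`-vector space with an additive operator `T` satisfying `T a = a T + δ(a)` is a module
over `K[t;δ]`. -/
noncomputable def actHom (T : Module.End F V) (hT : ∀ (a : K) v, T (a • v) = a • T v + δ a • v) :
    DiffPoly δ →+* Module.End F V where
  toFun f := act T (poly f)
  map_one' := by
    change act T (1 : K[X]) = 1
    rw [← monomial_zero_one, act_monomial]; simp
  map_zero' := act_zero T
  map_add' := act_add T
  map_mul' f g := act_mulPoly hT (poly f) (poly g)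

variable {T : Module.End F V} (hT : ∀ (a : K) v, T (a • v) = a • T v + δ a • v)

theorem actHom_smul (a : K) (f : DiffPoly δ) : actHom T hT (a • f) = a • actHom T hT f :=
  act_smul T a (poly f)

theorem actHom_monomial (i : ℕ) (a : K) :
    actHom T hT (ofPoly δ (monomial i a)) = a • T ^ i :=
  act_monomial T i a

theorem actHom_C (a : K) (v : V) : actHom T hT (ofPoly δ (C a)) v = a • v := by
  rw [← monomial_zero_left, actHom_monomial]; simp

theorem actHom_X_pow (i : ℕ) : actHom T hT (ofPoly δ (X ^ i)) = T ^ i := by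
  rw [← monomial_one_right_eq_X_pow, actHom_monomial, one_smul]

theorem act_comm {T : Module.End F V} {φ : V →ₗ[K] V} (h : ∀ v, φ (T v) = T (φ v)) (f : K[X])
    (v : V) : φ (act T f v) = act T f (φ v) := by
  have hpow : ∀ i : ℕ, φ ((T ^ i) v) = (T ^ i) (φ v) := by
    intro i
    induction i with
    | zero => simp
    | succ i ih => rw [pow_succ', Module.End.mul_apply, h, ih, Module.End.mul_apply]
  rw [act, Polynomial.sum, LinearMap.sum_apply, LinearMap.sum_apply, map_sum]
  exact Finset.sum_congr rfl fun i _ => by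
    rw [LinearMap.smul_apply, LinearMap.smul_apply, map_smul, hpow]

end Action

/-! ### Commutators with K and two-sided ideals. -/

section Independent

variable {F : Type u} {K : Type v} [Field F] [Field K] [Algebra F K] {δ : Derivation F K K}

theorem derivation_semilinear (δ : Derivation F K K) (a v : K) :
    δ.toLinearMap (a • v) = a • δ.toLinearMap v + δ a • v := by
  simp [mul_comm]

/-- If `1, δ, …, δ^(N-1)` are linearly independent over `K`, then a differential polynomial of
degree less than `N` that commutes with `K` is constant. -/
theorem natDegree_eq_zero_of_commute {N : ℕ}
    (hind : ∀ f : K[X], act δ.toLinearMap f = 0 → f.natDegree < N → f = 0)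
    {f : DiffPoly δ} (hf : f.natDegree < N)
    (hcomm : ∀ a : K, f * ofPoly δ (C a) - a • f = 0) : f.natDegree = 0 := by
  have hT := derivation_semilinear δ
  -- An f commuting with K acts on K as a K-linear map, so as multiplication by its value at 1. Then
  -- f - c acts as zero and independence applies.
  set c : K := actHom _ hT f 1 with hc
  have h0 : actHom _ hT (f - ofPoly δ (C c)) = 0 := by
    ext a
    have h1 := congrArg (fun g => actHom _ hT g 1) (hcomm a)
    simp only [map_sub, map_mul, LinearMap.sub_apply, Module.End.mul_apply, actHom_C, map_zero,
      LinearMap.zero_apply, actHom_smul, LinearMap.smul_apply, smul_eq_mul, mul_one] at h1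
    rw [map_sub, LinearMap.sub_apply, actHom_C, LinearMap.zero_apply, smul_eq_mul, hc, mul_comm]
    exact h1
  have h2 := hind _ h0 (by
    refine lt_of_le_of_lt (Polynomial.natDegree_sub_le _ _) (max_lt hf ?_)
    rw [ofPoly, natDegree_C]; omega)
  have h3 : f = ofPoly δ (C c) := sub_eq_zero.mp h2
  rw [h3, natDegree_ofPoly, natDegree_C]

/-- If `1, δ, …, δ^(N-1)` are linearly independent over `K`, then a two-sided ideal of `K[t;δ]`
that contains a nonzero element of degree less than `N` is the whole ring. -/
theorem one_mem_of_mem {N : ℕ}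
    (hind : ∀ f : K[X], act δ.toLinearMap f = 0 → f.natDegree < N → f = 0)
    (I : TwoSidedIdeal (DiffPoly δ)) {f : DiffPoly δ} (hfI : f ∈ I) (hf0 : f ≠ 0)
    (hf : f.natDegree < N) : 1 ∈ I := by
  induction h : f.natDegree using Nat.strong_induction_on generalizing f with
  | _ n ih =>
    by_cases hcomm : ∀ a : K, f * ofPoly δ (C a) - a • f = 0
    · obtain ⟨u, rfl⟩ := isUnit_iff.mpr ⟨hf0, natDegree_eq_zero_of_commute hind hf hcomm⟩
      rw [← u.inv_mul]
      exact I.mul_mem_left _ _ hfI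
    -- Otherwise some fa - af is a nonzero element of the ideal of smaller degree.
    · push Not at hcomm
      obtain ⟨a, ha⟩ := hcomm
      have hlt := natDegree_commutator_lt ha
      refine ih _ (h ▸ hlt) ?_ ha (hlt.trans hf) rfl
      rw [← ofPoly_C_mul]
      exact I.sub_mem (I.mul_mem_right _ _ hfI) (I.mul_mem_left _ _ hfI)

end Independent

end DiffPoly

/-! ### Derivations with a prescribed field of constants -/

/-- `g` maps the kernel of the (n+1)-st power into that of the n-th, and what it kills lies in a
space of dimension at most one. -/
theorem LinearMap.finrank_ker_pow_le {F V : Type*} [Field F] [AddCommGroup V] [Module F V]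
    [FiniteDimensional F V] (g : Module.End F V)
    (hg : Module.finrank F (LinearMap.ker g) ≤ 1) (n : ℕ) :
    Module.finrank F (LinearMap.ker (g ^ n)) ≤ n := by
  induction n with
  | zero => rw [pow_zero, Module.End.one_eq_id, LinearMap.ker_id, finrank_bot]
  | succ n ih =>
    let r : LinearMap.ker (g ^ (n + 1)) →ₗ[F] LinearMap.ker (g ^ n) :=
      (g.domRestrict _).codRestrict _ fun x => by
        rw [LinearMap.mem_ker, LinearMap.domRestrict_apply, ← Module.End.mul_apply, ← pow_succ]
        exact x.2
    have h1 := LinearMap.finrank_range_add_finrank_ker r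
    have h2 : Module.finrank F (LinearMap.range r) ≤ n :=
      (Submodule.finrank_le _).trans ih
    have h3 : Module.finrank F (LinearMap.ker r) ≤ 1 := by
      let s : LinearMap.ker r →ₗ[F] LinearMap.ker g :=
        ((Submodule.subtype _).comp (Submodule.subtype _)).codRestrict _ fun x => by
          have h := x.2
          rw [LinearMap.mem_ker] at h
          exact congrArg Subtype.val h
      refine (LinearMap.finrank_le_finrank_of_injective (f := s) ?_).trans hg
      intro x y h
      exact Subtype.ext (Subtype.ext (congrArg (fun z : LinearMap.ker g => (z : V)) h))
    omega

namespace Derivation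

section

variable {F : Type u} {L M : Type v} [Field F] [Field L] [Field M] [Algebra F L] [Algebra F M]
  [Algebra L M] [IsScalarTower F L M]

/-- The derivation of `L[X]` that restricts to `δ` on `L` and maps `X` to `y`. -/
noncomputable def polyExtend (δ : Derivation F L L) (y : L) : Derivation F L[X] L[X] :=
  Derivation.mk' (DiffPoly.coeffDeriv δ + (y • derivative).restrictScalars F) (by
    have h : ∀ a b : L[X], DiffPoly.coeffDeriv δ (a * b) =
        a * DiffPoly.coeffDeriv δ b + b * DiffPoly.coeffDeriv δ a := by
      intro a b
      ext n
      simp only [DiffPoly.coeffDeriv_coeff, coeff_mul, coeff_add, map_sum, leibniz,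
        Finset.sum_add_distrib, smul_eq_mul]
      congr 1
      rw [← Finset.Nat.sum_antidiagonal_swap]
      rfl
    intro a b
    simp only [LinearMap.add_apply, h, LinearMap.restrictScalars_apply, LinearMap.smul_apply,
      derivative_mul, smul_eq_mul, smul_eq_C_mul]
    ring)

theorem polyExtend_coeff (δ : Derivation F L L) (y : L) (q : L[X]) (n : ℕ) :
    (polyExtend δ y q).coeff n = δ (q.coeff n) + y * (q.coeff (n + 1) * (n + 1)) := by
  rw [polyExtend, coe_mk']
  simp [DiffPoly.coeffDeriv_coeff, coeff_derivative]

/-- Let `M = L(x)` with `x ^ p ∈ F` and `x ∉ L`. A nilpotent derivation of `L` with field of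
constants `F` extends to one of `M`. -/
theorem exists_extend {p : ℕ} [Fact p.Prime] [CharP F p] [FiniteDimensional F L]
    (x : M) (hxp : x ^ p ∈ (algebraMap F M).range) (hx : x ∉ (algebraMap L M).range)
    (hs : Function.Surjective (aeval x : L[X] →ₐ[L] M))
    (δ : Derivation F L L) (hδ : ∀ a, δ a = 0 → a ∈ (algebraMap F L).range)
    (hn : IsNilpotent (δ.toLinearMap : Module.End F L)) :
    ∃ δ' : Derivation F M M, (∀ a, δ' a = 0 → a ∈ (algebraMap F M).range) ∧
      IsNilpotent (δ'.toLinearMap : Module.End F M) := by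
  have hp : p.Prime := Fact.out
  have : CharP L p := charP_of_injective_algebraMap (algebraMap F L).injective p
  obtain ⟨a, ha⟩ := hxp
  -- a value outside of the image of `δ`
  obtain ⟨y, hy⟩ : ∃ y : L, ∀ z, δ z ≠ y := by
    by_contra! h
    have : Function.Injective (δ.toLinearMap : Module.End F L) :=
      LinearMap.injective_iff_surjective.mpr h
    exact one_ne_zero (this (a₁ := 1) (a₂ := 0) (by simp))
  set b : L := algebraMap F L a with hb
  -- A p-th root of b in L would equal x, because Frobenius is injective on M.
  have hirr : Irreducible (X ^ p - C b : L[X]) := by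
    refine X_pow_sub_C_irreducible_of_prime hp fun c hc => hx ⟨c, ?_⟩
    have : CharP M p := charP_of_injective_algebraMap (algebraMap F M).injective p
    have h1 : (algebraMap L M c) ^ p = x ^ p := by
      rw [← map_pow, hc, ← ha, hb, ← IsScalarTower.algebraMap_apply]
    exact frobenius_inj M p h1
  have hmin : minpoly L x = X ^ p - C b := by
    refine (minpoly.eq_of_irreducible_of_monic hirr ?_ (monic_X_pow_sub_C b hp.ne_zero)).symm
    rw [map_sub, map_pow, aeval_X, aeval_C, hb, ← IsScalarTower.algebraMap_apply, ha, sub_self]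
  have hzero : ∀ q : L[X], aeval x q = 0 → (X ^ p - C b) ∣ q := fun q hq => by
    rw [← hmin]; exact minpoly.dvd L x hq
  set D := polyExtend δ y with hD
  -- b comes from F and the derivative of X^p vanishes in characteristic p. So D preserves the ideal
  -- of X^p - b and descends to M.
  have hDb : D (X ^ p - C b) = 0 := by
    ext n
    rw [hD, polyExtend_coeff]
    have h1 : δ ((X ^ p - C b : L[X]).coeff n) = 0 := by
      rw [coeff_sub, coeff_X_pow, coeff_C, map_sub]
      split_ifs <;> simp [hb]
    have h2 : (X ^ p - C b : L[X]).coeff (n + 1) * ((n : L) + 1) = 0 := by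
      rw [coeff_sub, coeff_X_pow, coeff_C_succ, sub_zero]
      split_ifs with h
      · rw [one_mul, ← Nat.cast_succ, Nat.succ_eq_add_one, h, CharP.cast_eq_zero]
      · rw [zero_mul]
    rw [h1, h2, mul_zero, add_zero, coeff_zero]
  let f : L[X] →ₐ[F] M := (aeval x : L[X] →ₐ[L] M).restrictScalars F
  have hfs : Function.Surjective f := hs
  have hd : ∀ q, f q = 0 → f (D q) = 0 := by
    intro q hq
    obtain ⟨r, rfl⟩ := hzero q hq
    have h0 : f (X ^ p - C b) = 0 := by
      change aeval x _ = 0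
      rw [← hmin, minpoly.aeval]
    rw [leibniz, hDb, smul_zero, add_zero, smul_eq_mul, map_mul, h0, zero_mul]
  let δ' : Derivation F M M := liftOfSurjective hfs hd
  have hδ' : ∀ q, δ' (f q) = f (D q) := liftOfSurjective_apply hfs hd
  have hrep : ∀ z : M, ∃ q : L[X], q.natDegree < p ∧ f q = z := by
    intro z
    obtain ⟨q, rfl⟩ := hfs z
    refine ⟨q %ₘ (X ^ p - C b), ?_, ?_⟩
    · have := natDegree_modByMonic_lt q (monic_X_pow_sub_C b hp.ne_zero)
        (fun h => hirr.not_isUnit (h ▸ isUnit_one))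
      rwa [natDegree_X_pow_sub_C] at this
    · conv_rhs => rw [← modByMonic_add_div q (X ^ p - C b)]
      rw [map_add, map_mul]
      have h0 : f (X ^ p - C b) = 0 := by
        change aeval x _ = 0
        rw [← hmin, minpoly.aeval]
      rw [h0, zero_mul, add_zero]
  have hDdeg : ∀ (q : L[X]) (n : ℕ), q.natDegree ≤ n → (D q).natDegree ≤ n ∧
      (D q).coeff n = δ (q.coeff n) := by
    intro q n hq
    refine ⟨natDegree_le_iff_coeff_eq_zero.mpr fun k hk => ?_, ?_⟩
    · rw [hD, polyExtend_coeff, coeff_eq_zero_of_natDegree_lt (hq.trans_lt hk),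
        coeff_eq_zero_of_natDegree_lt ((hq.trans_lt hk).trans (Nat.lt_succ_self k))]
      simp
    · rw [hD, polyExtend_coeff,
        coeff_eq_zero_of_natDegree_lt (hq.trans_lt (Nat.lt_succ_self n))]
      simp
  refine ⟨δ', fun z hz => ?_, ?_⟩
  · obtain ⟨q, hq, rfl⟩ := hrep z
    rw [hδ'] at hz
    have hDq : D q = 0 := by
      by_contra h0
      have h1 := natDegree_le_of_dvd (hzero _ hz) h0
      rw [natDegree_X_pow_sub_C] at h1
      have := (hDdeg q _ le_rfl).1
      omega
    -- If q has degree n + 1 > 0 and D q = 0, its top coefficient is a nonzero c in F, and the next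
    -- coefficient gives δ(q_n) = -(n+1)c y. As n + 1 < p, the factor (n+1)c is invertible in F,
    -- which puts y in the image of δ.
    have hq0 : q.natDegree = 0 := by
      by_contra hne
      obtain ⟨n, hn'⟩ := Nat.exists_eq_succ_of_ne_zero hne
      have h1 : δ (q.coeff (n + 1)) = 0 := by
        rw [← (hDdeg q (n + 1) (by omega)).2, hDq, coeff_zero]
      obtain ⟨c, hc⟩ := hδ _ h1
      have h2 : δ (q.coeff n) + y * (q.coeff (n + 1) * (n + 1)) = 0 := by
        rw [← polyExtend_coeff, ← hD, hDq, coeff_zero]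
      have hc0 : c ≠ 0 := by
        rintro rfl
        rw [map_zero, ← Nat.succ_eq_add_one, ← hn', coeff_natDegree, eq_comm,
          leadingCoeff_eq_zero] at hc
        rw [hc, natDegree_zero] at hne
        exact hne rfl
      have hn0 : ((n : F) + 1) ≠ 0 := by
        rw [← Nat.cast_succ, Ne, CharP.cast_eq_zero_iff F p]
        intro h
        have := Nat.le_of_dvd (Nat.succ_pos n) h
        omega
      refine hy ((-(c * (n + 1))⁻¹) • q.coeff n) ?_
      have h3 : q.coeff (n + 1) * ((n : L) + 1) = algebraMap F L (c * (n + 1)) := by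
        rw [map_mul, map_add, _root_.map_natCast, map_one, hc]
      have h4 : algebraMap F L (c * (n + 1)) ≠ 0 := by
        rw [Ne, map_eq_zero]; exact mul_ne_zero hc0 hn0
      rw [h3] at h2
      rw [Derivation.map_smul, Algebra.smul_def, map_neg, map_inv₀, eq_neg_of_add_eq_zero_left h2]
      field_simp
    rw [eq_C_of_natDegree_eq_zero hq0] at hDq ⊢
    have h1 : δ (q.coeff 0) = 0 := by
      have := (hDdeg (C (q.coeff 0)) 0 (by rw [natDegree_C])).2
      rwa [hDq, coeff_zero, coeff_C_zero, eq_comm] at this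
    obtain ⟨c, hc⟩ := hδ _ h1
    refine ⟨c, ?_⟩
    change _ = aeval x (C (q.coeff 0))
    rw [aeval_C, ← hc, ← IsScalarTower.algebraMap_apply]
  · obtain ⟨N, hN⟩ := hn
    have hDpow : ∀ (n j : ℕ) (q : L[X]), q.natDegree ≤ n →
        ((D.toLinearMap ^ j) q).natDegree ≤ n ∧
        ((D.toLinearMap ^ j) q).coeff n = (δ.toLinearMap ^ j) (q.coeff n) := by
      intro n j q hq
      induction j with
      | zero => simpa using hq
      | succ j ih =>
        rw [pow_succ', pow_succ', Module.End.mul_apply, Module.End.mul_apply]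
        have := hDdeg _ n ih.1
        exact ⟨this.1, by rw [← ih.2]; exact this.2⟩
    -- D acts on the top coefficient as δ, so N applications of D kill it and lower the degree.
    have hnil : ∀ (n : ℕ) (q : L[X]), q.natDegree < n → (D.toLinearMap ^ (N * n)) q = 0 := by
      intro n
      induction n with
      | zero => intro q hq; omega
      | succ n ih =>
        intro q hq
        have h1 := hDpow n N q (by omega)
        rw [mul_add, mul_one, pow_add, Module.End.mul_apply]
        rw [hN, LinearMap.zero_apply] at h1
        rcases Nat.eq_zero_or_pos n with rfl | hn
        · rw [eq_C_of_natDegree_le_zero h1.1, h1.2, C_0, map_zero]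
        · refine ih _ (lt_of_le_of_ne h1.1 fun h => ?_)
          have h2 := h1.2
          conv at h2 => lhs; rw [← h]
          rw [coeff_natDegree, leadingCoeff_eq_zero] at h2
          rw [h2, natDegree_zero] at h
          omega
    refine ⟨N * p, ?_⟩
    have hpow : ∀ (j : ℕ) (q : L[X]), (δ'.toLinearMap ^ j) (f q) = f ((D.toLinearMap ^ j) q) := by
      intro j q
      induction j with
      | zero => simp
      | succ j ih =>
        rw [pow_succ', pow_succ', Module.End.mul_apply, Module.End.mul_apply, ih]
        exact hδ' _
    ext z
    obtain ⟨q, hq, rfl⟩ := hrep z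
    rw [hpow, hnil p q hq, map_zero, LinearMap.zero_apply]

end

section

variable {F : Type u} {K : Type v} [Field F] [Field K] [Algebra F K]

/-- A finite purely inseparable extension of exponent at most one has a nilpotent derivation whose
field of constants is the ground field. -/
theorem exists_nilpotent_constants {p : ℕ} [Fact p.Prime] [CharP F p] [FiniteDimensional F K]
    (hexp : ∀ x : K, x ^ p ∈ (algebraMap F K).range) :
    ∃ δ : Derivation F K K, (∀ a, δ a = 0 → a ∈ (algebraMap F K).range) ∧
      IsNilpotent (δ.toLinearMap : Module.End F K) := by
  have key : ∀ L : IntermediateField F K,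
      ∃ δ : Derivation F L L, (∀ a, δ a = 0 → a ∈ (algebraMap F L).range) ∧
        IsNilpotent (δ.toLinearMap : Module.End F L) := by
    intro L
    induction L using IntermediateField.induction_on_adjoin with
    | base =>
      refine ⟨0, fun a _ => ?_, ⟨1, by rw [pow_one]; rfl⟩⟩
      obtain ⟨c, hc⟩ := IntermediateField.mem_bot.mp a.2
      exact ⟨c, Subtype.ext hc⟩
    | ih L x h =>
      obtain ⟨δ, hδ, hn⟩ := h
      by_cases hx : x ∈ L
      · have : (IntermediateField.adjoin L {x}).restrictScalars F = L := by
          have hbot : IntermediateField.adjoin L {x} = ⊥ :=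
            IntermediateField.adjoin_simple_eq_bot_iff.mpr
              (IntermediateField.mem_bot.mpr ⟨⟨x, hx⟩, rfl⟩)
          rw [hbot]
          ext z
          simp
        rw [this]
        exact ⟨δ, hδ, hn⟩
      · let M := (IntermediateField.adjoin L {x}).restrictScalars F
        have hLM : L ≤ M := fun z hz =>
          (IntermediateField.adjoin L {x}).algebraMap_mem ⟨z, hz⟩
        have hxM : x ∈ M := IntermediateField.mem_adjoin_simple_self L x
        let : Algebra L M := (IntermediateField.inclusion hLM).toRingHom.toAlgebra
        have : IsScalarTower F L M := IsScalarTower.of_algebraMap_eq fun _ => rfl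
        have : IsScalarTower L M K := IsScalarTower.of_algebraMap_eq fun _ => rfl
        refine exists_extend (p := p) (M := M) ⟨x, hxM⟩ ?_ ?_ ?_ δ hδ hn
        · obtain ⟨c, hc⟩ := hexp x
          exact ⟨c, Subtype.ext hc⟩
        · rintro ⟨z, hz⟩
          have : (z : K) = x := congrArg Subtype.val hz
          exact hx (this ▸ z.2)
        · have hint : IsIntegral L x := (Algebra.IsIntegral.of_finite L K).isIntegral x
          intro z
          have hz : (z : K) ∈ (IntermediateField.adjoin L {x}).toSubalgebra := z.2
          rw [IntermediateField.adjoin_simple_toSubalgebra_of_isAlgebraic hint.isAlgebraic,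
            Algebra.adjoin_singleton_eq_range_aeval] at hz
          obtain ⟨q, hq⟩ := hz
          refine ⟨q, Subtype.ext ?_⟩
          exact (aeval_algebraMap_apply K (⟨x, hxM⟩ : M) q).symm.trans hq
  -- The derivation of the top intermediate field is carried over to K.
  obtain ⟨δ, hδ, N, hN⟩ := key ⊤
  let e : (⊤ : IntermediateField F K) ≃ₐ[F] K := IntermediateField.topEquiv
  let D : K →ₗ[F] K := e.toLinearMap ∘ₗ δ.toLinearMap ∘ₗ e.symm.toLinearMap
  have hD : ∀ a, D a = e (δ (e.symm a)) := fun _ => rfl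
  let δ' : Derivation F K K := Derivation.mk' D fun a b => by
    simp only [hD, map_mul, leibniz, map_add, smul_eq_mul, AlgEquiv.apply_symm_apply]
  have hδ' : ∀ a, δ' a = e (δ (e.symm a)) := fun _ => rfl
  refine ⟨δ', fun a ha => ?_, N, ?_⟩
  · rw [hδ', map_eq_zero_iff e e.injective] at ha
    obtain ⟨c, hc⟩ := hδ _ ha
    exact ⟨c, by rw [← e.apply_symm_apply a, ← hc, AlgEquiv.commutes]⟩
  · have hpow : ∀ (j : ℕ) a, (δ'.toLinearMap ^ j) a = e ((δ.toLinearMap ^ j) (e.symm a)) := by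
      intro j a
      induction j with
      | zero => simp
      | succ j ih =>
        rw [pow_succ', pow_succ', Module.End.mul_apply, Module.End.mul_apply, ih]
        change e (δ (e.symm _)) = _
        rw [e.symm_apply_apply]
        rfl
    ext a
    rw [hpow, hN]
    simp

/-! ### Powers of a nilpotent derivation with constants F. -/

theorem finrank_ker_le_one (δ : Derivation F K K)
    (hδ : ∀ a, δ a = 0 → a ∈ (algebraMap F K).range) :
    Module.finrank F (LinearMap.ker (δ.toLinearMap : Module.End F K)) ≤ 1 := by
  refine finrank_le_one (⟨1, by simp⟩ : LinearMap.ker (δ.toLinearMap : Module.End F K)) ?_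
  rintro ⟨a, ha⟩
  obtain ⟨c, hc⟩ := hδ a ha
  exact ⟨c, Subtype.ext (by simp [← hc, Algebra.smul_def])⟩

theorem finrank_le_of_pow_eq_zero [FiniteDimensional F K] (δ : Derivation F K K)
    (hδ : ∀ a, δ a = 0 → a ∈ (algebraMap F K).range) {n : ℕ}
    (hn : (δ.toLinearMap : Module.End F K) ^ n = 0) : Module.finrank F K ≤ n := by
  have h := LinearMap.finrank_ker_pow_le _ (finrank_ker_le_one δ hδ) n
  rwa [hn, LinearMap.ker_zero, finrank_top] at h

/-- Nilpotency makes the minimal polynomial some X^k. Counting kernels gives k ≥ [K:F], and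
divisibility into the characteristic polynomial gives k ≤ [K:F]. -/
theorem minpoly_eq_X_pow [FiniteDimensional F K] (δ : Derivation F K K)
    (hδ : ∀ a, δ a = 0 → a ∈ (algebraMap F K).range)
    (hn : IsNilpotent (δ.toLinearMap : Module.End F K)) :
    minpoly F (δ.toLinearMap : Module.End F K) = X ^ Module.finrank F K := by
  obtain ⟨N, hN⟩ := hn
  have h1 : minpoly F (δ.toLinearMap : Module.End F K) ∣ X ^ N := minpoly.dvd _ _ (by simp [hN])
  obtain ⟨k, hk, hk'⟩ := (dvd_prime_pow prime_X N).mp h1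
  have hmon : (minpoly F (δ.toLinearMap : Module.End F K)).Monic :=
    minpoly.monic (Algebra.IsIntegral.isIntegral _)
  have h2 := eq_of_monic_of_associated hmon (monic_X_pow k) hk'
  have h3 := minpoly.aeval F (δ.toLinearMap : Module.End F K)
  rw [h2, map_pow, aeval_X] at h3
  have h4 := finrank_le_of_pow_eq_zero δ hδ h3
  have h5 := LinearMap.minpoly_dvd_charpoly (δ.toLinearMap : Module.End F K)
  have h6 := natDegree_le_of_dvd h5 (LinearMap.charpoly_monic _).ne_zero
  rw [LinearMap.charpoly_natDegree, h2, natDegree_X_pow] at h6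
  rw [h2, le_antisymm h6 h4]

/-- The powers of a nilpotent derivation with field of constants `F` are linearly independent over
`K` up to the dimension of `K` over `F`. -/
theorem eq_zero_of_act_eq_zero [FiniteDimensional F K] (δ : Derivation F K K)
    (hδ : ∀ a, δ a = 0 → a ∈ (algebraMap F K).range)
    (hn : IsNilpotent (δ.toLinearMap : Module.End F K)) (f : K[X])
    (hf : DiffPoly.act (δ.toLinearMap : Module.End F K) f = 0)
    (hdeg : f.natDegree < Module.finrank F K) : f = 0 := by
  set g : Module.End F K := δ.toLinearMap with hg
  set N := Module.finrank F K with hN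
  have hN0 : 0 < N := Module.finrank_pos
  have h0 : g ^ N = 0 := by
    have h := minpoly.aeval F g
    rwa [minpoly_eq_X_pow δ hδ hn, map_pow, aeval_X] at h
  obtain ⟨w, hw⟩ : ∃ w, (g ^ (N - 1)) w ≠ 0 := by
    by_contra! h
    have := finrank_le_of_pow_eq_zero δ hδ (n := N - 1) (LinearMap.ext h)
    omega
  by_contra hne
  -- Evaluating f at g^(N-1-i) w leaves only the lowest term: every higher one contains g^N = 0,
  -- while the lowest gives its coefficient times g^(N-1) w ≠ 0.
  set i := f.natTrailingDegree with hi
  have hile : i ≤ f.natDegree := natTrailingDegree_le_natDegree f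
  have h1 := congrArg (fun h => h ((g ^ (N - 1 - i)) w)) hf
  simp only [DiffPoly.act, Polynomial.sum, LinearMap.sum_apply, LinearMap.zero_apply,
    LinearMap.smul_apply] at h1
  rw [Finset.sum_eq_single i] at h1
  · rw [← Module.End.mul_apply, ← pow_add, show i + (N - 1 - i) = N - 1 by omega,
      smul_eq_mul, mul_eq_zero] at h1
    rcases h1 with h1 | h1
    · exact hne (trailingCoeff_eq_zero.mp h1)
    · exact hw h1
  · intro j hj hji
    have : i ≤ j := natTrailingDegree_le_of_mem_supp j hj
    rw [← Module.End.mul_apply, ← pow_add,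
      show j + (N - 1 - i) = (j - i - 1) + N by omega, pow_add, h0]
    simp
  · intro h
    rw [notMem_support_iff.mp h, zero_smul]

end

end Derivation

/-! ### Bimodules from a splitting field -/

section Matrix

variable {K : Type*} [Field K] {n : Type*} [Fintype n] [DecidableEq n]

/-- Every derivation of a matrix algebra over a field is inner. -/
theorem Matrix.exists_eq_commutator [Nonempty n]
    (D : Matrix n n K →ₗ[K] Matrix n n K) (hD : ∀ X Y, D (X * Y) = D X * Y + X * D Y) :
    ∃ P : Matrix n n K, ∀ X, D X = P * X - X * P := by
  obtain ⟨o⟩ := ‹Nonempty n›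
  let E : n → n → Matrix n n K := fun i j => Matrix.single i j 1
  have hE : ∀ i j k l, E i j * E k l = if j = k then E i l else 0 := by
    intro i j k l
    split_ifs with h
    · subst h; simp [E]
    · simp [E, h]
  have hE1 : ∑ i, E i i = 1 := by
    ext a b
    rw [Matrix.sum_apply, Finset.sum_eq_single a]
    · simp [E, Matrix.single_apply, Matrix.one_apply]
    · intro i _ hi
      simp [E, hi]
    · simp
  -- This is D applied to the first factors of the separability element ∑ E_io ⊗ E_oi. That element
  -- commutes with all matrices and multiplies out to 1, which yields P X = D(X) + X P.
  set P : Matrix n n K := ∑ i, D (E i o) * E o i with hP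
  have key : ∀ k l, D (E k l) = P * E k l - E k l * P := by
    intro k l
    have h1 : P * E k l = D (E k o) * E o l := by
      rw [hP, Finset.sum_mul, Finset.sum_eq_single k]
      · rw [mul_assoc, hE, if_pos rfl]
      · intro i _ hik
        rw [mul_assoc, hE, if_neg hik, mul_zero]
      · simp
    have h2 : E k l * P = D (E k o) * E o l - D (E k l) := by
      have h3 : ∀ i, E k l * (D (E i o) * E o i) =
          D (E k l * E i o) * E o i - D (E k l) * E i i := by
        intro i
        rw [hD, add_mul, ← mul_assoc, mul_assoc (D (E k l)), hE i o o i, if_pos rfl]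
        abel
      rw [hP, Finset.mul_sum, Finset.sum_congr rfl fun i _ => h3 i, Finset.sum_sub_distrib,
        ← Finset.mul_sum, hE1, mul_one, Finset.sum_eq_single l]
      · rw [hE, if_pos rfl]
      · intro i _ hil
        rw [hE, if_neg (Ne.symm hil), map_zero, zero_mul]
      · simp
    rw [h1, h2]; abel
  refine ⟨P, fun X => ?_⟩
  have hX : X = ∑ i, ∑ j, X i j • E i j := by
    conv_lhs => rw [Matrix.matrix_eq_sum_single X]
    simp [E, Matrix.smul_single]
  rw [hX]
  simp only [map_sum, map_smul, key, Finset.mul_sum, Finset.sum_mul, mul_smul_comm,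
    smul_mul_assoc, smul_sub, Finset.sum_sub_distrib]

end Matrix

section Bimodule

variable {F : Type u} {K : Type v} {B : Type w} [Field F] [Field K] [Algebra F K]
  [Ring B] [Algebra F B]

/-- A `K[t;δ]`-module structure on a `K`-vector space `V`, given by the operator `T` of `t`,
together with a right action of `B` that identifies `B` with the endomorphism ring of this
module. -/
structure DiffBimodule (δ : Derivation F K K) (B : Type w) [Ring B] [Algebra F B] (V : Type*)
    [AddCommGroup V] [Module F V] [Module K V] [IsScalarTower F K V] where
  /-- The action of `t`. -/
  T : Module.End F V
  semilinear : ∀ (a : K) v, T (a • v) = a • T v + δ a • v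
  /-- The right action of `B`. -/
  ρ : B →ₗ[F] Module.End K V
  ρ_one : ρ 1 = 1
  ρ_mul : ∀ b c, ρ (b * c) = ρ c * ρ b
  ρ_injective : Function.Injective ρ
  ρ_T : ∀ b v, ρ b (T v) = T (ρ b v)
  exists_eq_ρ : ∀ φ : Module.End K V, (∀ v, φ (T v) = T (φ v)) → ∃ b, φ = ρ b

theorem IsSplitBy.exists_algEquiv {m : ℕ} (hsplit : IsSplitBy F B K)
    (hB : Module.finrank F B = m ^ 2) : Nonempty (K ⊗[F] B ≃ₐ[K] Matrix (Fin m) (Fin m) K) := by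
  obtain ⟨n, ⟨e⟩⟩ := hsplit
  have h := e.toLinearEquiv.finrank_eq
  rw [Module.finrank_baseChange, hB, Module.finrank_matrix] at h
  simp only [Fintype.card_fin, Module.finrank_self, mul_one, ← pow_two] at h
  obtain rfl : m = n := Nat.pow_left_injective two_ne_zero h
  exact ⟨e⟩

/-- The sequence F → K → K given by the inclusion and δ is exact, and tensoring with `B` over a
field keeps it exact. -/
theorem Derivation.mem_range_of_rTensor_eq_zero {δ : Derivation F K K}
    (hδ : ∀ a, δ a = 0 → a ∈ (algebraMap F K).range) {x : K ⊗[F] B}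
    (hx : δ.toLinearMap.rTensor B x = 0) : ∃ b : B, x = 1 ⊗ₜ[F] b := by
  have hex : Function.Exact (Algebra.linearMap F K) δ.toLinearMap := by
    intro a
    constructor
    · intro h
      obtain ⟨c, hc⟩ := hδ a h
      exact ⟨c, hc⟩
    · rintro ⟨c, rfl⟩
      simp
  obtain ⟨y, rfl⟩ := (Module.Flat.rTensor_exact B hex x).mp hx
  refine ⟨TensorProduct.lid F B y, ?_⟩
  clear hx
  induction y using TensorProduct.induction_on with
  | zero => simp
  | add y z hy hz => rw [map_add, map_add, TensorProduct.tmul_add, ← hy, ← hz]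
  | tmul c b => simp [Algebra.algebraMap_eq_smul_one, TensorProduct.smul_tmul]

/-- Both the entrywise derivation `D₁` and the transported δ ⊗ 1, called `D₂`, extend δ, so `D₁ -
D₂` is K-linear, hence X ↦ PX - XP. With T(v) = δ(v) + vP, a matrix X acting on row vectors commutes
with T exactly when D₁X = PX - XP, that is D₂X = 0, and these X are the image of 1 ⊗ B. -/
theorem IsSplitBy.exists_diffBimodule {m : ℕ} [NeZero m] [IsSimpleRing B]
    {δ : Derivation F K K}
    (hδ : ∀ a, δ a = 0 → a ∈ (algebraMap F K).range) (hsplit : IsSplitBy F B K)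
    (hB : Module.finrank F B = m ^ 2) : Nonempty (DiffBimodule δ B (Fin m → K)) := by
  obtain ⟨e⟩ := hsplit.exists_algEquiv hB
  let D₁ : Matrix (Fin m) (Fin m) K →ₗ[F]
    Matrix (Fin m) (Fin m) K := δ.toLinearMap.mapMatrix
  let D₂ : Matrix (Fin m) (Fin m) K →ₗ[F]
    Matrix (Fin m) (Fin m) K := (e.toLinearEquiv.restrictScalars F).toLinearMap ∘ₗ
    δ.toLinearMap.rTensor B ∘ₗ (e.toLinearEquiv.restrictScalars F).symm.toLinearMap
  have hD₁ : ∀ X i j, D₁ X i j = δ (X i j) := fun _ _ _ => rfl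
  have hD₂ : ∀ x, D₂ (e x) = e (δ.toLinearMap.rTensor B x) := fun x => by
    change e (δ.toLinearMap.rTensor B (e.symm (e x))) = _
    rw [e.symm_apply_apply]
  have hl₁ : ∀ X Y, D₁ (X * Y) = D₁ X * Y + X * D₁ Y := by
    intro X Y
    ext i j
    simp only [hD₁, Matrix.mul_apply, Matrix.add_apply, map_sum, Derivation.leibniz,
      smul_eq_mul, ← Finset.sum_add_distrib]
    exact Finset.sum_congr rfl fun k _ => by ring
  have hs₁ : ∀ (a : K) X, D₁ (a • X) = a • D₁ X + δ a • X := by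
    intro a X
    ext i j
    simp only [hD₁, Matrix.smul_apply, Matrix.add_apply, Derivation.leibniz, smul_eq_mul]
    ring
  have hlt : ∀ x y : K ⊗[F] B, δ.toLinearMap.rTensor B (x * y) =
      δ.toLinearMap.rTensor B x * y + x * δ.toLinearMap.rTensor B y := by
    intro x y
    induction x using TensorProduct.induction_on with
    | zero => simp
    | add x x' hx hx' => simp only [add_mul, map_add, hx, hx']; abel
    | tmul a b =>
      induction y using TensorProduct.induction_on with
      | zero => simp
      | add y y' hy hy' => simp only [mul_add, map_add, hy, hy']; abel
      | tmul c d =>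
        simp only [Algebra.TensorProduct.tmul_mul_tmul, LinearMap.rTensor_tmul,
          Derivation.coeFn_coe, Derivation.leibniz, TensorProduct.add_tmul, smul_eq_mul]
        rw [mul_comm c, add_comm]
  have hst : ∀ (a : K) (x : K ⊗[F] B), δ.toLinearMap.rTensor B (a • x) =
      a • δ.toLinearMap.rTensor B x + δ a • x := by
    intro a x
    induction x using TensorProduct.induction_on with
    | zero => simp
    | add x x' hx hx' => simp only [smul_add, map_add, hx, hx']; abel
    | tmul c d =>
      simp only [TensorProduct.smul_tmul', LinearMap.rTensor_tmul,
        Derivation.coeFn_coe, Derivation.leibniz, TensorProduct.add_tmul, smul_eq_mul]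
      rw [mul_comm c]
  have hl₂ : ∀ X Y, D₂ (X * Y) = D₂ X * Y + X * D₂ Y := by
    intro X Y
    obtain ⟨x, rfl⟩ := e.surjective X
    obtain ⟨y, rfl⟩ := e.surjective Y
    rw [← map_mul, hD₂, hD₂, hD₂, hlt, map_add, map_mul, map_mul]
  have hs₂ : ∀ (a : K) X, D₂ (a • X) = a • D₂ X + δ a • X := by
    intro a X
    obtain ⟨x, rfl⟩ := e.surjective X
    rw [← map_smul, hD₂, hD₂, hst, map_add, map_smul, map_smul]
  let Δ : Matrix (Fin m) (Fin m) K →ₗ[K] Matrix (Fin m) (Fin m) K :=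
    { toFun := fun X => D₁ X - D₂ X
      map_add' := fun X Y => by rw [map_add, map_add]; abel
      map_smul' := fun a X => by rw [hs₁, hs₂, RingHom.id_apply, smul_sub]; abel }
  obtain ⟨P, hP⟩ := Matrix.exists_eq_commutator Δ fun X Y => by
    change D₁ _ - D₂ _ = (D₁ X - D₂ X) * Y + X * (D₁ Y - D₂ Y)
    rw [hl₁, hl₂, sub_mul, mul_sub]; abel
  have hP' : ∀ X, D₁ X - D₂ X = P * X - X * P := hP
  let ψ : B →ₐ[F] Matrix (Fin m) (Fin m) K :=
      (e.toAlgHom.restrictScalars F).comp Algebra.TensorProduct.includeRight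
  have hψ : ∀ b, ψ b = e (1 ⊗ₜ b) := fun _ => rfl
  have hψD : ∀ b, D₁ (ψ b) = P * ψ b - ψ b * P := by
    intro b
    rw [← hP', hψ, hD₂]
    simp
  have hDψ : ∀ X, D₁ X = P * X - X * P → ∃ b, X = ψ b := by
    intro X hX
    obtain ⟨x, rfl⟩ := e.surjective X
    have h := hP' (e x)
    rw [hX, hD₂, sub_eq_self, map_eq_zero_iff e e.injective] at h
    obtain ⟨b, rfl⟩ := Derivation.mem_range_of_rTensor_eq_zero hδ h
    exact ⟨b, rfl⟩
  let T₀ : Module.End F (Fin m → K) := LinearMap.compLeft δ.toLinearMap (Fin m)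
  have hT₀ : ∀ v i, T₀ v i = δ (v i) := fun _ _ => rfl
  have hT₀X : ∀ v (X : Matrix (Fin m) (Fin m) K), T₀ (Matrix.vecMul v X) =
      Matrix.vecMul (T₀ v) X + Matrix.vecMul v (D₁ X) := by
    intro v X
    ext i
    simp only [hT₀, hD₁, Pi.add_apply, Matrix.vecMul, dotProduct, map_sum,
      Derivation.leibniz, smul_eq_mul, ← Finset.sum_add_distrib]
    exact Finset.sum_congr rfl fun k _ => by ring
  -- Vectors are rows and matrices act on the right, hence the transposes.
  let T : Module.End F (Fin m → K) := T₀ + (Matrix.toLin' P.transpose).restrictScalars F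
  have hT : ∀ v, T v = T₀ v + Matrix.vecMul v P := fun v => by
    change T₀ v + Matrix.mulVec P.transpose v = _
    rw [Matrix.mulVec_transpose]
  have hcomm : ∀ X v, Matrix.vecMul (T v) X - T (Matrix.vecMul v X) =
      Matrix.vecMul v (P * X - X * P - D₁ X) := by
    intro X v
    rw [hT, hT, hT₀X, Matrix.add_vecMul, Matrix.vecMul_sub, Matrix.vecMul_sub,
      Matrix.vecMul_vecMul, Matrix.vecMul_vecMul]
    abel
  let ρ : B →ₗ[F] Module.End K (Fin m → K) :=
    { toFun := fun b => Matrix.toLin' (ψ b).transpose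
      map_add' := fun b c => by rw [map_add, Matrix.transpose_add, map_add]
      map_smul' := fun a b => by
        ext v i
        simp [Matrix.transpose_smul] }
  have hρ : ∀ b v, ρ b v = Matrix.vecMul v (ψ b) := fun b v => by
    rw [← Matrix.mulVec_transpose]; rfl
  exact ⟨{
    T := T
    semilinear := fun a v => by
      rw [hT, hT, smul_add, Matrix.smul_vecMul]
      have : T₀ (a • v) = a • T₀ v + δ a • v := by
        ext i
        simp [hT₀, mul_comm]
      rw [this]; abel
    ρ := ρ
    ρ_one := LinearMap.ext fun v => by rw [hρ, map_one, Matrix.vecMul_one]; rfl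
    ρ_mul := fun b c => LinearMap.ext fun v => by
      rw [Module.End.mul_apply, hρ, hρ, hρ, map_mul, Matrix.vecMul_vecMul]
    ρ_injective := fun b c h => by
      have h1 : (ψ b).transpose = (ψ c).transpose := Matrix.toLin'.injective h
      exact (ψ : B →+* Matrix (Fin m) (Fin m) K).injective (Matrix.transpose_injective h1)
    ρ_T := fun b v => by
      rw [hρ, hρ, ← sub_eq_zero, hcomm, hψD, sub_self, Matrix.vecMul_zero]
    exists_eq_ρ := fun φ hφ => by
      set X : Matrix (Fin m) (Fin m) K := (LinearMap.toMatrix' φ).transpose with hX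
      have hφX : ∀ v, φ v = Matrix.vecMul v X := fun v => by
        rw [hX, Matrix.vecMul_transpose, LinearMap.toMatrix'_mulVec]
      obtain ⟨b, hb⟩ := hDψ X <| by
        rw [eq_comm, ← sub_eq_zero]
        refine Matrix.transpose_injective (Matrix.toLin'.injective (LinearMap.ext fun v => ?_))
        rw [Matrix.toLin'_apply, Matrix.mulVec_transpose, ← hcomm, ← hφX, ← hφX, hφ, sub_self]
        simp
      exact ⟨b, LinearMap.ext fun v => by rw [hφX, hρ, hb]⟩ }⟩

open Classical in
/-- The theorem of Skolem and Noether for algebras split by a field. -/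
theorem IsSplitBy.exists_eq_conj {m : ℕ} [NeZero m] [IsSimpleRing B] [FiniteDimensional F B]
    (hsplit : IsSplitBy F B K) (hB : Module.finrank F B = m ^ 2) (α : B ≃ₐ[F] B) :
    ∃ b : Bˣ, ∀ x, α x = b * x * (b⁻¹ : Bˣ) := by
  obtain ⟨e⟩ := hsplit.exists_algEquiv hB
  let e' : K ⊗[F] B ≃ₐ[K] Module.End K (Fin m → K) := e.trans Matrix.toLinAlgEquiv'
  -- After base change α is an automorphism of a full endomorphism algebra, so it is conjugation by
  -- some `g`.
  let f := (e'.symm.trans (Algebra.TensorProduct.congr AlgEquiv.refl α)).trans e'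
  obtain ⟨g, hg⟩ := f.eq_linearEquivConjAlgEquiv
  set u : K ⊗[F] B := e'.symm g.toLinearMap with hu
  have hu0 : u ≠ 0 := by
    rw [hu, Ne, map_eq_zero_iff _ e'.symm.injective]
    intro h
    have := g.injective.eq_iff (a := 1) (b := 0)
    have h1 := LinearMap.congr_fun h 1
    have h2 : g 1 = 0 := h1
    rw [map_eq_zero_iff _ g.injective] at h2
    exact one_ne_zero h2
  have hux : ∀ x : B, u * (1 ⊗ₜ x) = (1 ⊗ₜ α x) * u := by
    intro x
    apply e'.injective
    rw [map_mul, map_mul, hu, e'.apply_symm_apply]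
    have h1 : e' (1 ⊗ₜ α x) = f (e' (1 ⊗ₜ x)) := by simp [f]
    rw [h1, hg]
    refine LinearMap.ext fun v => ?_
    simp [LinearEquiv.conjAlgEquiv_apply]
  -- The relation u(1 ⊗ x) = (1 ⊗ α x)u holds in each coordinate with respect to an F-basis of K. A
  -- nonzero coordinate descends the intertwiner from K ⊗ B to `B`.
  let b := Module.Basis.ofVectorSpace F K
  let E := TensorProduct.equivFinsuppOfBasisLeft (N := B) b
  have hEr : ∀ (x : B) y i, E (y * (1 ⊗ₜ x)) i = E y i * x := by
    intro x y i
    induction y using TensorProduct.induction_on with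
    | zero => simp
    | add y z hy hz => simp only [add_mul, map_add, Finsupp.add_apply, hy, hz]
    | tmul c d => simp [E]
  have hEl : ∀ (x : B) y i, E ((1 ⊗ₜ x) * y) i = x * E y i := by
    intro x y i
    induction y using TensorProduct.induction_on with
    | zero => simp
    | add y z hy hz => simp only [mul_add, map_add, Finsupp.add_apply, hy, hz]
    | tmul c d => simp [E]
  obtain ⟨i, hi⟩ : ∃ i, E u i ≠ 0 := by
    by_contra! h
    exact hu0 (by rw [← map_eq_zero_iff E E.injective]; exact Finsupp.ext h)
  set c := E u i with hc
  have hcx : ∀ x, c * x = α x * c := fun x => by rw [hc, ← hEr, hux, hEl]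
  -- The left ideal Bc is two-sided because cx = α(x)c, so simplicity makes it all of `B`.
  obtain ⟨d, hd⟩ : ∃ d, d * c = 1 := by
    let I : Ideal B := Ideal.span {c}
    have : I.IsTwoSided := ⟨fun {a} x ha => by
      obtain ⟨d, rfl⟩ := Ideal.mem_span_singleton'.mp ha
      rw [mul_assoc, hcx, ← mul_assoc]
      exact Ideal.mem_span_singleton'.mpr ⟨_, rfl⟩⟩
    have hI : I = ⊤ := by
      rcases (isSimpleRing_iff_isTwoSided_imp.mp ‹IsSimpleRing B›).2 I this with h | h
      · exact absurd (Ideal.span_singleton_eq_bot.mp h) hi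
      · exact h
    have h1 : (1 : B) ∈ I := hI ▸ Submodule.mem_top
    exact Ideal.mem_span_singleton'.mp h1
  have hcd : c * d = 1 := by
    have : IsArtinianRing B := IsArtinianRing.of_finite F B
    exact mul_eq_one_symm hd
  refine ⟨⟨c, d, hcd, hd⟩, fun x => ?_⟩
  change α x = c * x * d
  rw [hcx, mul_assoc, hcd, mul_one]

end Bimodule

/-! ### Cyclic modules -/

/-- Over a simple Artinian algebra, a module whose dimension is at most that of the algebra is
cyclic. -/
theorem IsSimpleRing.exists_cyclic (F : Type*) {A V : Type*} [Field F] [Ring A] [Algebra F A]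
    [FiniteDimensional F A] [IsSimpleRing A] [AddCommGroup V] [Module F V] [Module A V]
    [IsScalarTower F A V] [FiniteDimensional F V]
    (h : Module.finrank F V ≤ Module.finrank F A) : ∃ v : V, ∀ w, ∃ a : A, a • v = w := by
  have : IsArtinianRing A := IsArtinianRing.of_finite F A
  have : Module.Finite A V := Module.Finite.of_restrictScalars_finite F A V
  cases subsingleton_or_nontrivial V with
  | inl _ => exact ⟨0, fun w => ⟨0, Subsingleton.elim _ _⟩⟩
  | inr _ =>
    -- Both A and V are powers of one simple module, A ≅ S^q and V ≅ S^r. Dimensions give r ≤ q, and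
    -- the image of 1 under a projection S^q → S^r is a generator.
    obtain ⟨q, _, S, hS, ⟨e⟩⟩ := (IsSimpleRing.isIsotypic A A).linearEquiv_fun
    obtain ⟨r, _, S', hS', ⟨e'⟩⟩ := (IsSimpleRing.isIsotypic A V).linearEquiv_fun
    obtain ⟨I, ⟨i⟩⟩ := IsSemisimpleRing.exists_linearEquiv_ideal_of_isSimpleModule A S'
    have : IsSimpleModule A I := IsSimpleModule.congr i.symm
    obtain ⟨j⟩ := IsSimpleRing.isIsotypic A A S I
    let e'' : V ≃ₗ[A] (Fin r → S) := e'.trans (LinearEquiv.piCongrRight fun _ => i.trans j)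
    have hq : Module.finrank F A = q * Module.finrank F S := by
      rw [(e.restrictScalars F).finrank_eq, Module.finrank_pi_fintype]; simp
    have hr : Module.finrank F V = r * Module.finrank F S := by
      rw [(e''.restrictScalars F).finrank_eq, Module.finrank_pi_fintype]; simp
    have : Nontrivial S := IsSimpleModule.nontrivial A S
    have hS0 : 0 < Module.finrank F S := by
      have : FiniteDimensional F S :=
        FiniteDimensional.finiteDimensional_submodule (S.restrictScalars F)
      exact Module.finrank_pos
    have hrq : r ≤ q := by
      rw [hq, hr] at h
      exact Nat.le_of_mul_le_mul_right h hS0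
    let s : A →ₗ[A] V := e''.symm.toLinearMap ∘ₗ
      LinearMap.funLeft A S (Fin.castLE hrq) ∘ₗ e.toLinearMap
    have hs : Function.Surjective s :=
      e''.symm.surjective.comp ((LinearMap.funLeft_surjective_of_injective A S _
        (Fin.castLE_injective hrq)).comp e.surjective)
    refine ⟨s 1, fun w => ?_⟩
    obtain ⟨a, rfl⟩ := hs w
    exact ⟨a, by rw [← map_smul, smul_eq_mul, mul_one]⟩

/-! ### The image of K[t;δ]: simplicity, cyclicity, semisimplicity. -/

namespace DiffBimodule

open DiffPoly

section

variable {F : Type u} {K : Type v} {B : Type w} [Field F] [Field K] [Algebra F K]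
  [Ring B] [Algebra F B] {δ : Derivation F K K} {V : Type*} [AddCommGroup V] [Module F V]
  [Module K V] [IsScalarTower F K V] (M : DiffBimodule δ B V)

/-- The action of `K[t;δ]` on the module. -/
noncomputable def hom : DiffPoly δ →+* Module.End F V := actHom M.T M.semilinear

theorem hom_smul (a : K) (f : DiffPoly δ) (v : V) : M.hom (a • f) v = a • M.hom f v := by
  rw [hom, actHom_smul, LinearMap.smul_apply]

theorem hom_C (a : K) (v : V) : M.hom (ofPoly δ (C a)) v = a • v := actHom_C M.semilinear a v

theorem hom_X_pow (i : ℕ) : M.hom (ofPoly δ (X ^ i)) = M.T ^ i := actHom_X_pow M.semilinear i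

theorem hom_X : M.hom (ofPoly δ X) = M.T := by
  rw [← pow_one X, hom_X_pow, pow_one]

theorem ρ_hom (b : B) (f : DiffPoly δ) (v : V) : M.ρ b (M.hom f v) = M.hom f (M.ρ b v) :=
  act_comm (M.ρ_T b) (poly f) v

/-- An additive endomorphism that commutes with the elements of `K[t;δ]` is given by an element of
`B`. -/
theorem exists_eq_ρ_of_commute (φ : V →+ V)
    (h : ∀ (f : DiffPoly δ) v, φ (M.hom f v) = M.hom f (φ v)) :
    ∃ b, ∀ v, φ v = M.ρ b v := by
  obtain ⟨b, hb⟩ := M.exists_eq_ρ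
    { toFun := φ, map_add' := φ.map_add, map_smul' := fun a v => by
        rw [← hom_C M, h, hom_C, RingHom.id_apply] } fun v => by
      change φ _ = M.T (φ v)
      rw [← hom_X, h]
  exact ⟨b, fun v => LinearMap.congr_fun hb v⟩

/-- Left and right multiplication by T commute, and their difference sends the scalar operator a to
δ(a). In characteristic p the p^e-th power of the difference is the difference of the powers, so the
commutator of T^(p^e) with a is δ^(p^e)(a) = 0. -/
theorem pow_char_commute {p e : ℕ} [Fact p.Prime] [CharP F p] [Nontrivial V]
    (hnil : (δ.toLinearMap : Module.End F K) ^ p ^ e = 0) (a : K) (v : V) :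
    (M.T ^ p ^ e) (a • v) = a • (M.T ^ p ^ e) v := by
  have : CharP (Module.End F (Module.End F V)) p := charP_of_injective_algebraMap 
      (algebraMap F (Module.End F (Module.End F V))).injective p
  let l : Module.End F (Module.End F V) := LinearMap.mulLeft F M.T
  let r : Module.End F (Module.End F V) := LinearMap.mulRight F M.T
  have hlr : Commute l r := LinearMap.commute_mulLeft_right (R := F) M.T M.T
  let S : K → Module.End F V := fun a => a • 1
  have hS : ∀ a, (l - r) (S a) = S (δ a) := by
    intro a
    ext v
    simp [l, r, S, M.semilinear]
  have hSj : ∀ (j : ℕ) a, ((l - r) ^ j) (S a) = S ((δ.toLinearMap ^ j) a) := by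
    intro j
    induction j with
    | zero => intro a; simp
    | succ j ih =>
      intro a
      rw [pow_succ, pow_succ, Module.End.mul_apply, Module.End.mul_apply, hS, ih]
      rfl
  have h := hSj (p ^ e) a
  rw [sub_pow_char_pow_of_commute p e hlr, hnil] at h
  have hl : l ^ p ^ e = LinearMap.mulLeft F (M.T ^ p ^ e) := LinearMap.pow_mulLeft _ _ _ _
  have hr : r ^ p ^ e = LinearMap.mulRight F (M.T ^ p ^ e) := LinearMap.pow_mulRight _ _ _ _
  rw [hl, hr] at h
  have h1 := LinearMap.congr_fun h v
  simp only [S, LinearMap.sub_apply, LinearMap.mulLeft_apply, LinearMap.mulRight_apply,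
    Module.End.mul_apply, LinearMap.smul_apply, Module.End.one_apply, LinearMap.zero_apply,
    zero_smul, sub_eq_zero] at h1
  exact h1

/-- Being K-linear and commuting with T, the operator T^(p^e) is given by an element of `B`. It
commutes with all of `B`, since `B` commutes with T, so it is central. The scalar found lies in F.
-/
theorem exists_pow_char_eq {p e : ℕ} [Fact p.Prime] [CharP F p] [Nontrivial V]
    [Algebra.IsCentral F B]
    (hnil : (δ.toLinearMap : Module.End F K) ^ p ^ e = 0) :
    ∃ d : K, ∀ v, (M.T ^ p ^ e) v = d • v := by
  obtain ⟨b, hb⟩ := M.exists_eq_ρ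
    { toFun := ⇑(M.T ^ p ^ e), map_add' := map_add (M.T ^ p ^ e), map_smul' :=
        M.pow_char_commute hnil }
    fun v => by
      change (M.T ^ p ^ e) (M.T v) = M.T ((M.T ^ p ^ e) v)
      rw [← Module.End.mul_apply, ← Module.End.mul_apply, ← pow_succ, ← pow_succ']
  have hb' : ∀ v, (M.T ^ p ^ e) v = M.ρ b v := fun v => LinearMap.congr_fun hb v
  have hcen : b ∈ Subalgebra.center F B := by
    refine Subalgebra.mem_center_iff.mpr fun c => M.ρ_injective ?_
    ext v
    rw [M.ρ_mul, M.ρ_mul, Module.End.mul_apply, Module.End.mul_apply, ← hb', ← hb', ← hom_X_pow,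
      ρ_hom]
  obtain ⟨d, rfl⟩ := Algebra.mem_bot.mp (Algebra.IsCentral.out hcen)
  refine ⟨algebraMap F K d, fun v => ?_⟩
  rw [hb', Algebra.algebraMap_eq_smul_one, map_smul, M.ρ_one, LinearMap.smul_apply,
    Module.End.one_apply, algebraMap_smul]

/-- The image of `K[t;δ]` in the endomorphisms of the module. -/
noncomputable def imageAlgebra : Subalgebra F (Module.End F V) where
  carrier := Set.range M.hom
  mul_mem' := by
    rintro _ _ ⟨f, rfl⟩ ⟨g, rfl⟩
    exact ⟨f * g, map_mul _ _ _⟩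
  add_mem' := by
    rintro _ _ ⟨f, rfl⟩ ⟨g, rfl⟩
    exact ⟨f + g, map_add _ _ _⟩
  algebraMap_mem' c := ⟨ofPoly δ (C (algebraMap F K c)), by
    ext v
    rw [hom_C, algebraMap_smul]
    rfl⟩

theorem hom_mem (f : DiffPoly δ) : M.hom f ∈ M.imageAlgebra := ⟨f, rfl⟩

/-- The action of `K[t;δ]`, as a surjection onto its image. -/
noncomputable def toImage : DiffPoly δ →+* M.imageAlgebra :=
  M.hom.codRestrict M.imageAlgebra M.hom_mem

theorem toImage_surjective : Function.Surjective M.toImage := by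
  rintro ⟨_, f, rfl⟩
  exact ⟨f, rfl⟩

/-- A nonzero element of small degree in the kernel would put 1 there. -/
theorem eq_zero_of_hom_eq_zero [Nontrivial V] {N : ℕ}
    (hind : ∀ f : K[X], act δ.toLinearMap f = 0 → f.natDegree < N → f = 0) {f : DiffPoly δ}
    (hf : M.hom f = 0)
    (hdeg : f.natDegree < N) : f = 0 := by
  by_contra h
  have h1 := one_mem_of_mem hind (TwoSidedIdeal.ker M.hom)
    ((TwoSidedIdeal.mem_ker _).mpr hf) h hdeg
  rw [TwoSidedIdeal.mem_ker, map_one] at h1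
  exact one_ne_zero h1

/-- As t^N - d acts as zero, every element of the image is represented by a remainder of degree
below N, and a nonzero remainder generates the unit two-sided ideal. -/
theorem isSimpleRing_imageAlgebra [Nontrivial V] {N : ℕ}
    (hind : ∀ f : K[X], act δ.toLinearMap f = 0 → f.natDegree < N → f = 0) (hN : N ≠ 0) {d : K}
    (hd : ∀ v, (M.T ^ N) v = d • v) : IsSimpleRing M.imageAlgebra := by
  rw [isSimpleRing_iff_isTwoSided_imp]
  refine ⟨inferInstance, fun I _ => ?_⟩
  rw [or_iff_not_imp_left]
  intro hI
  obtain ⟨x, hxI, hx0⟩ := Submodule.exists_mem_ne_zero_of_ne_bot hI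
  obtain ⟨g, rfl⟩ := M.toImage_surjective x
  set h : DiffPoly δ := ofPoly δ (X ^ N - C d) with hh
  have hh0 : h ≠ 0 := (monic_X_pow_sub_C d hN).ne_zero
  have hhdeg : h.natDegree = N := natDegree_X_pow_sub_C
  have hhom : M.toImage h = 0 := by
    refine Subtype.ext (LinearMap.ext fun v => ?_)
    change M.hom h v = 0
    rw [hh, ofPoly_sub, map_sub, LinearMap.sub_apply, hom_X_pow, hom_C, hd, sub_self]
  obtain ⟨q, r, hqr, hr⟩ := exists_eq_mul_add hh0 g
  have hgr : M.toImage g = M.toImage r := by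
    rw [hqr, map_add, map_mul, hhom, mul_zero, zero_add]
  rw [hgr] at hxI hx0
  have hr0 : r ≠ 0 := fun h => hx0 (by rw [h, map_zero])
  have h1 := one_mem_of_mem hind ((I.toTwoSided).comap M.toImage) (f := r) (by
    rw [TwoSidedIdeal.mem_comap]; exact (Ideal.mem_toTwoSided).mpr hxI) hr0 (by
    rw [hhdeg] at hr
    exact (natDegree_lt_iff_degree_lt hr0).mpr hr)
  rw [TwoSidedIdeal.mem_comap, map_one] at h1
  exact (Ideal.eq_top_iff_one I).mpr (Ideal.mem_toTwoSided.mp h1)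

/-- Differential polynomials of degree below N act faithfully. -/
theorem finrank_imageAlgebra_ge [Nontrivial V] {N : ℕ}
    (hind : ∀ f : K[X], act δ.toLinearMap f = 0 → f.natDegree < N → f = 0) [FiniteDimensional F K]
    [FiniteDimensional F V]
    (hN : N ≠ 0) : N * Module.finrank F K ≤ Module.finrank F M.imageAlgebra := by
  let s : degreeLT K N →ₗ[F] M.imageAlgebra :=
    { toFun := fun f => M.toImage (ofPoly δ f)
      map_add' := fun f g => map_add M.toImage (ofPoly δ f) (ofPoly δ g)
      map_smul' := fun c f => by
        refine Subtype.ext (LinearMap.ext fun v => ?_)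
        have h : ofPoly δ ((c • f : degreeLT K N) : K[X]) =
            algebraMap F K c • ofPoly δ (f : K[X]) := by
          rw [algebraMap_smul]; rfl
        change M.hom (ofPoly δ ((c • f : degreeLT K N) : K[X])) v = c • M.hom (ofPoly δ f) v
        rw [h, hom_smul, algebraMap_smul] }
  have hs : Function.Injective s := by
    rw [← LinearMap.ker_eq_bot, LinearMap.ker_eq_bot']
    intro f hf
    refine Subtype.ext (M.eq_zero_of_hom_eq_zero hind (congrArg Subtype.val hf) ?_)
    have := mem_degreeLT.mp f.2
    change (f : K[X]).natDegree < N
    by_cases h0 : (f : K[X]) = 0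
    · rw [h0, Polynomial.natDegree_zero]; omega
    · exact (natDegree_lt_iff_degree_lt h0).mpr this
  have h1 := LinearMap.finrank_le_finrank_of_injective hs
  rwa [((degreeLTEquiv K N).restrictScalars F).finrank_eq, Module.finrank_pi_fintype,
    Finset.sum_const, Finset.card_univ, Fintype.card_fin, smul_eq_mul] at h1

theorem exists_cyclic [Nontrivial V] {N : ℕ}
    (hind : ∀ f : K[X], act δ.toLinearMap f = 0 → f.natDegree < N → f = 0) [FiniteDimensional F K]
    [FiniteDimensional F V]
    (hN : N ≠ 0) {d : K} (hd : ∀ v, (M.T ^ N) v = d • v) (hV : Module.finrank K V ≤ N) :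
    ∃ v, ∀ w, ∃ f : DiffPoly δ, M.hom f v = w := by
  have := M.isSimpleRing_imageAlgebra hind hN hd
  obtain ⟨v, hv⟩ := IsSimpleRing.exists_cyclic F (A := M.imageAlgebra) (V := V) <| by
    rw [← Module.finrank_mul_finrank F K V, mul_comm]
    exact (Nat.mul_le_mul_right _ hV).trans (M.finrank_imageAlgebra_ge hind hN)
  refine ⟨v, fun w => ?_⟩
  obtain ⟨a, ha⟩ := hv w
  obtain ⟨f, rfl⟩ := M.toImage_surjective a
  exact ⟨f, ha⟩

/-- The module is semisimple: a submodule is the image of an idempotent of `B`. -/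
theorem exists_projection [Nontrivial V] {N : ℕ}
    (hind : ∀ f : K[X], act δ.toLinearMap f = 0 → f.natDegree < N → f = 0) [FiniteDimensional F V]
    (hN : N ≠ 0) {d : K} (hd : ∀ v, (M.T ^ N) v = d • v) (W : AddSubgroup V)
    (hW : ∀ (f : DiffPoly δ), ∀ w ∈ W, M.hom f w ∈ W) :
    ∃ b : B, (∀ v, M.ρ b v ∈ W) ∧ ∀ w ∈ W, M.ρ b w = w := by
  have := M.isSimpleRing_imageAlgebra hind hN hd
  have : IsArtinianRing M.imageAlgebra := IsArtinianRing.of_finite F _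
  let W' : Submodule M.imageAlgebra V :=
    { W with
      smul_mem' := fun a w hw => by
        obtain ⟨f, rfl⟩ := M.toImage_surjective a
        exact hW f w hw }
  -- The image algebra is simple Artinian, so complements exist. The projection along one commutes
  -- with K[t;δ] and therefore comes from `B`.
  obtain ⟨U, hU⟩ := exists_isCompl W'
  let φ : V →ₗ[M.imageAlgebra] W' := W'.projectionOnto U hU
  obtain ⟨b, hb⟩ := M.exists_eq_ρ_of_commute (W'.subtype.comp φ).toAddMonoidHom fun f v => by
    change (φ (M.toImage f • v) : V) = M.toImage f • (φ v : V)
    rw [map_smul]; rfl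
  refine ⟨b, fun v => ?_, fun w hw => ?_⟩
  · rw [← hb]
    exact (φ v).2
  · rw [← hb]
    exact congrArg Subtype.val (Submodule.projectionOnto_apply_left hU ⟨w, hw⟩)

end

end DiffBimodule

/-! ### Division algebras -/

theorem isDivisionAlgebra_of_mul_eq_zero (F : Type*) {A : Type*} [Field F]
    [NonUnitalNonAssocRing A] [Module F A] [IsScalarTower F A A] [SMulCommClass F A A]
    [FiniteDimensional F A] [Nontrivial A] (h : ∀ x y : A, x * y = 0 → x = 0 ∨ y = 0) :
    IsDivisionAlgebra A := by
  refine ⟨inferInstance, fun a ha => ⟨?_, ?_⟩⟩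
  · have hi : Function.Injective (LinearMap.mulLeft F a) := by
      rw [← LinearMap.ker_eq_bot, LinearMap.ker_eq_bot']
      exact fun x hx => (h a x hx).resolve_left ha
    exact ⟨hi, LinearMap.injective_iff_surjective.mp hi⟩
  · have hi : Function.Injective (LinearMap.mulRight F a) := by
      rw [← LinearMap.ker_eq_bot, LinearMap.ker_eq_bot']
      exact fun x hx => (h x a hx).resolve_right ha
    exact ⟨hi, LinearMap.injective_iff_surjective.mp hi⟩

theorem IsDivisionAlgebra.eq_zero_or_eq_zero {A : Type*} [NonUnitalNonAssocRing A]
    (h : IsDivisionAlgebra A) {x y : A} (hxy : x * y = 0) : x = 0 ∨ y = 0 := by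
  rw [or_iff_not_imp_left]
  intro hx
  refine (h.2 x hx).1.1 ?_
  change x * y = x * 0
  rw [hxy, mul_zero]

/-! ### Degrees and constants in S_f. -/

namespace PetitAlgebra

open DiffPoly

section

variable {F : Type u} {K : Type v} [Field F] [Field K] [Algebra F K] {δ : Derivation F K K}
  {f : DiffPoly δ}

theorem natDegree_toDiffPoly_lt (hf : f.natDegree ≠ 0) (x : PetitAlgebra f) :
    (toDiffPoly x).natDegree < f.natDegree := by
  have := mem_degreeLT.mp x.2
  by_cases h0 : toDiffPoly x = 0
  · rw [h0]
    exact lt_of_eq_of_lt Polynomial.natDegree_zero (Nat.pos_of_ne_zero hf)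
  · exact (natDegree_lt_iff_degree_lt h0).mpr this

theorem toDiffPoly_injective : Function.Injective (toDiffPoly (f := f)) := fun _ _ h =>
  Subtype.ext h

theorem toDiffPoly_red {g : DiffPoly δ} (hg : g.natDegree < f.natDegree) :
    toDiffPoly (red g : PetitAlgebra f) = g := by
  have h : poly g ∈ degreeLT K f.natDegree := by
    rw [mem_degreeLT]
    exact lt_of_le_of_lt degree_le_natDegree (by exact_mod_cast hg)
  obtain ⟨x, hx⟩ : ∃ x : PetitAlgebra f, toDiffPoly x = g := ⟨⟨poly g, h⟩, rfl⟩
  rw [← hx, red_toDiffPoly]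

theorem toDiffPoly_const (hf : f.natDegree ≠ 0) (a : K) :
    toDiffPoly (const f a) = a • (1 : DiffPoly δ) := by
  change toDiffPoly (a • (1 : PetitAlgebra f)) = _
  rw [toDiffPoly_smul]
  congr 1
  exact toDiffPoly_red_one hf

theorem exists_const_of_natDegree_eq_zero (hf : f.natDegree ≠ 0) {x : PetitAlgebra f}
    (hx : (toDiffPoly x).natDegree = 0) : x ∈ Set.range (const f) :=
  ⟨_, toDiffPoly_injective (by
    rw [toDiffPoly_const hf]; exact (eq_smul_one_of_natDegree_eq_zero hx).symm)⟩

theorem const_injective (hf : f.natDegree ≠ 0) : Function.Injective (const f) := by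
  intro a b h
  have h1 := congrArg toDiffPoly h
  rw [toDiffPoly_const hf, toDiffPoly_const hf, ← ofPoly_C, ← ofPoly_C] at h1
  exact C_injective h1

/-- If `deg g + deg h = deg f`, then `gh` differs from `g ∘ h` by a nonzero constant multiple
of `f`. -/
theorem exists_mul_eq_smul_add (hf : f ≠ 0) {x y : PetitAlgebra f} (hx : toDiffPoly x ≠ 0)
    (hy : toDiffPoly y ≠ 0)
    (hxy : (toDiffPoly x).natDegree + (toDiffPoly y).natDegree = f.natDegree)
    (hf0 : f.natDegree ≠ 0) :
    ∃ c : K, c ≠ 0 ∧ toDiffPoly x * toDiffPoly y = c • f + toDiffPoly (x * y) := by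
  obtain ⟨q, hq⟩ := modR_spec hf (toDiffPoly x * toDiffPoly y)
  have hq' : toDiffPoly x * toDiffPoly y = q * f + toDiffPoly (x * y) := hq
  have hlt := natDegree_toDiffPoly_lt hf0 (x * y)
  have hdeg := DiffPoly.natDegree_mul hx hy
  have hq0 : q ≠ 0 := by
    rintro rfl
    rw [zero_mul, zero_add] at hq'
    rw [hq'] at hdeg
    omega
  have hqd : q.natDegree = 0 := by
    have h1 : (q * f).natDegree ≤ f.natDegree := by
      rw [← sub_eq_iff_eq_add.mpr hq']
      refine (Polynomial.natDegree_sub_le _ _).trans (max_le ?_ hlt.le)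
      exact le_of_eq (hdeg.trans hxy)
    rw [DiffPoly.natDegree_mul hq0 hf] at h1
    omega
  have hqc := eq_smul_one_of_natDegree_eq_zero hqd
  refine ⟨q.poly.coeff 0, ?_, ?_⟩
  swap
  · rw [hq']
    congr 1
    rw [← one_mul f, ← DiffPoly.smul_mul', ← hqc, one_mul]
  intro h
  rw [h, zero_smul] at hqc
  exact hq0 hqc

end

end PetitAlgebra

/-! ### S_f as a cyclic module. -/

namespace DiffBimodule

open DiffPoly PetitAlgebra

section

variable {F : Type u} {K : Type v} {B : Type w} [Field F] [Field K] [Algebra F K]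
  [Ring B] [Algebra F B] {δ : Derivation F K K} {V : Type*} [AddCommGroup V] [Module F V]
  [Module K V] [IsScalarTower F K V]

/-- The element `v` generates the module, and `f` generates the annihilator of `v`. -/
structure IsCyclic (M : DiffBimodule δ B V) (v : V) (f : DiffPoly δ) : Prop where
  ne_zero : f ≠ 0
  hom_eq_zero : M.hom f v = 0
  eq_zero : ∀ g, M.hom g v = 0 → g.natDegree < f.natDegree → g = 0
  exists_eq : ∀ w, ∃ g : DiffPoly δ, M.hom g v = w

/-- The annihilator of v is nonzero because it contains t^N - d; an element of least degree is
taken. -/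
theorem exists_isCyclic (M : DiffBimodule δ B V) {v : V}
    (hv : ∀ w, ∃ g : DiffPoly δ, M.hom g v = w) {N : ℕ} (hN : N ≠ 0) {d : K}
    (hd : ∀ v, (M.T ^ N) v = d • v) : ∃ f, M.IsCyclic v f := by
  classical
  have hex : ∃ n, ∃ f : DiffPoly δ, f ≠ 0 ∧ M.hom f v = 0 ∧ f.natDegree = n := by
    refine ⟨_, ofPoly δ (X ^ N - C d), (monic_X_pow_sub_C d hN).ne_zero, ?_, rfl⟩
    rw [ofPoly_sub, map_sub, LinearMap.sub_apply, hom_X_pow, hom_C, hd, sub_self]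
  obtain ⟨f, hf0, hfv, hfn⟩ := Nat.find_spec hex
  refine ⟨f, hf0, hfv, fun g hg hlt => ?_, hv⟩
  by_contra hg0
  exact Nat.find_min hex (hfn ▸ hlt) ⟨g, hg0, hg, rfl⟩

namespace IsCyclic

variable {M : DiffBimodule δ B V} {v : V} {f : DiffPoly δ}

/-- The identification of `S_f` with the cyclic module. -/
noncomputable def val (hc : M.IsCyclic v f) : PetitAlgebra f ≃ₗ[K] V :=
  LinearEquiv.ofBijective
    { toFun := fun x => M.hom (toDiffPoly x) v
      map_add' := fun x y => by rw [toDiffPoly_add, map_add, LinearMap.add_apply]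
      map_smul' := fun a x => by rw [toDiffPoly_smul, hom_smul, RingHom.id_apply] } <| by
    have hsurj : ∀ w, ∃ x : PetitAlgebra f, M.hom (toDiffPoly x) v = w := by
      intro w
      obtain ⟨g, rfl⟩ := hc.exists_eq w
      obtain ⟨q, hq⟩ := modR_spec hc.ne_zero g
      refine ⟨red g, ?_⟩
      conv_rhs => rw [hq]
      rw [map_add, map_mul, LinearMap.add_apply, Module.End.mul_apply, hc.hom_eq_zero, map_zero,
        zero_add]
      rfl
    refine ⟨LinearMap.ker_eq_bot.mp (LinearMap.ker_eq_bot'.mpr fun x hx => ?_), hsurj⟩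
    by_cases hf : f.natDegree = 0
    · exact eq_of_natDegree_eq_zero hf _ _
    · exact toDiffPoly_injective (hc.eq_zero _ hx (natDegree_toDiffPoly_lt hf x))

theorem val_apply (hc : M.IsCyclic v f) (x : PetitAlgebra f) : hc.val x = M.hom (toDiffPoly x) v :=
    rfl

theorem val_red (hc : M.IsCyclic v f) (g : DiffPoly δ) : hc.val (red g) = M.hom g v := by
  obtain ⟨q, hq⟩ := modR_spec hc.ne_zero g
  rw [val_apply]
  conv_rhs => rw [hq]
  rw [map_add, map_mul, LinearMap.add_apply, Module.End.mul_apply, hc.hom_eq_zero, map_zero,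
    zero_add]
  rfl

/-- Because f kills v, passing to the remainder of a product does not change its effect on v.
Associators thereby become questions about the action on V. -/
theorem val_mul (hc : M.IsCyclic v f) (x y : PetitAlgebra f) : hc.val (x * y) = M.hom
    (toDiffPoly x) (hc.val y) := by
  rw [PetitAlgebra.mul_def, val_red, map_mul, Module.End.mul_apply, val_apply]

theorem val_one (hc : M.IsCyclic v f) : hc.val 1 = v := by
  change hc.val (red 1) = v
  rw [val_red, map_one, Module.End.one_apply]

theorem val_const (hc : M.IsCyclic v f) (a : K) : hc.val (const f a) = a • v := by
  change hc.val (a • (1 : PetitAlgebra f)) = _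
  rw [map_smul, val_one]

theorem natDegree_eq (hc : M.IsCyclic v f) : f.natDegree = Module.finrank K V := by
  rw [← hc.val.finrank_eq]
  change _ = Module.finrank K (degreeLT K f.natDegree)
  rw [(degreeLTEquiv K _).finrank_eq, Module.finrank_fin_fun]

/-- The embedding of `B` into `S_f`. -/
noncomputable def embed (hc : M.IsCyclic v f) : B →ₙₐ[F] PetitAlgebra f where
  toFun b := hc.val.symm (M.ρ b v)
  map_smul' c b := by
    rw [map_smul, LinearMap.smul_apply, ← algebraMap_smul K c (M.ρ b v), map_smul, algebraMap_smul]
    rfl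
  map_zero' := by rw [map_zero, LinearMap.zero_apply, map_zero]
  map_add' b c := by rw [map_add, LinearMap.add_apply, map_add]
  map_mul' b c := by
    apply hc.val.injective
    rw [val_mul, LinearEquiv.apply_symm_apply, LinearEquiv.apply_symm_apply, ← M.ρ_hom,
      ← hc.val_apply,
      LinearEquiv.apply_symm_apply, M.ρ_mul, Module.End.mul_apply]

theorem val_embed (hc : M.IsCyclic v f) (b : B) : hc.val (hc.embed b) = M.ρ b v :=
  hc.val.apply_symm_apply _

theorem embed_one (hc : M.IsCyclic v f) : hc.embed 1 = 1 := by
  apply hc.val.injective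
  rw [val_embed, M.ρ_one, val_one, Module.End.one_apply]

theorem embed_injective (hc : M.IsCyclic v f) : Function.Injective hc.embed := by
  intro b c h
  apply M.ρ_injective
  ext w
  obtain ⟨g, rfl⟩ := hc.exists_eq w
  rw [M.ρ_hom, M.ρ_hom, ← hc.val_embed, h, hc.val_embed]

/-! ### Associators and nuclei. -/

theorem associator_eq_zero_iff (hc : M.IsCyclic v f) (x y z : PetitAlgebra f) :
    associator x y z = 0 ↔
    M.hom (toDiffPoly (x * y)) (hc.val z) =
      M.hom (toDiffPoly x) (M.hom (toDiffPoly y) (hc.val z)) := by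
  rw [associator, sub_eq_zero, ← hc.val.injective.eq_iff, val_mul, val_mul, val_mul]

theorem embed_mem_rightNucleus (hc : M.IsCyclic v f) (b : B) : hc.embed b ∈ rightNucleus
    (PetitAlgebra f) := by
  intro y z
  rw [hc.associator_eq_zero_iff, val_embed, ← M.ρ_hom, ← M.ρ_hom, ← M.ρ_hom, ← hc.val_apply,
    ← hc.val_apply, val_mul]

theorem const_mem_leftNucleus (a : K) : const f a ∈ leftNucleus (PetitAlgebra f) := by
  intro y z
  change associator (a • (1 : PetitAlgebra f)) y z = 0
  rw [associator, smul_mul_left, smul_mul_left, smul_mul_left, one_mul, one_mul, sub_self]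

/-- Multiplying by a constant on the right does not raise the degree, so the product y a needs no
reduction modulo f. -/
theorem const_mem_middleNucleus (hc : M.IsCyclic v f) (hf : f.natDegree ≠ 0) (a : K) :
    const f a ∈ middleNucleus (PetitAlgebra f) := by
  intro y z
  rw [hc.associator_eq_zero_iff, ← Module.End.mul_apply, ← map_mul, PetitAlgebra.mul_def,
    toDiffPoly_red]
  rw [toDiffPoly_const hf, ← ofPoly_C]
  have hy := natDegree_toDiffPoly_lt hf y
  by_cases h : toDiffPoly y = 0
  · rw [h, zero_mul]
    rwa [h] at hy
  by_cases ha : a = 0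
  · rw [ha, C_0, show ofPoly δ (0 : K[X]) = 0 from rfl, mul_zero]
    exact lt_of_eq_of_lt Polynomial.natDegree_zero (Nat.pos_of_ne_zero hf)
  · rw [DiffPoly.natDegree_mul h (f := ofPoly δ (C a)) (fun h0 => ha (C_eq_zero.mp h0)),
      natDegree_ofPoly, natDegree_C, add_zero]
    exact hy

/-- Here xy = cf + x ∘ y with c ≠ 0, so [x,y,z] corresponds to -c f(zv) in V. This one computation
bounds all three nuclei. -/
theorem smul_hom_eq_zero (hc : M.IsCyclic v f) (hf : f.natDegree ≠ 0) {x y z : PetitAlgebra f}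
    (hx : toDiffPoly x ≠ 0)
    (hy : toDiffPoly y ≠ 0)
    (hxy : (toDiffPoly x).natDegree + (toDiffPoly y).natDegree = f.natDegree)
    (h : associator x y z = 0) : M.hom f (hc.val z) = 0 := by
  obtain ⟨c, hc0, hcf⟩ := exists_mul_eq_smul_add hc.ne_zero hx hy hxy hf
  rw [hc.associator_eq_zero_iff, ← Module.End.mul_apply, ← map_mul, hcf, map_add,
    LinearMap.add_apply, right_eq_add, hom_smul, smul_eq_zero] at h
  exact h.resolve_left hc0

theorem X_pow_facts {i : ℕ} (hi : i < f.natDegree) :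
    toDiffPoly (red (ofPoly δ (X ^ i)) : PetitAlgebra f) ≠ 0 ∧
      (toDiffPoly (red (ofPoly δ (X ^ i)) : PetitAlgebra f)).natDegree = i := by
  have h : (ofPoly δ (X ^ i)).natDegree = i := natDegree_X_pow i
  rw [toDiffPoly_red (by rwa [h])]
  exact ⟨(monic_X_pow i).ne_zero, h⟩

theorem hom_eq_zero_of_mem_rightNucleus (hc : M.IsCyclic v f) (hf : 2 ≤ f.natDegree)
    {x : PetitAlgebra f}
    (hx : x ∈ rightNucleus (PetitAlgebra f)) : M.hom f (hc.val x) = 0 := by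
  -- The pair t^(m-1), t has degrees adding up to m; both lie in S_f because m ≥ 2.
  have h1 := X_pow_facts (f := f) (i := f.natDegree - 1) (by omega)
  have h2 := X_pow_facts (f := f) (i := 1) (by omega)
  exact hc.smul_hom_eq_zero (by omega) h1.1 h2.1 (by rw [h1.2, h2.2]; omega) (hx _ _)

/-- When f kills xv, the assignment gv ↦ g(xv) is well defined. It is an endomorphism of the
K[t;δ]-module V, hence an element of `B`, and it sends v to xv. -/
theorem mem_range_embed (hc : M.IsCyclic v f) (hf : 2 ≤ f.natDegree) {x : PetitAlgebra f}
    (hx : x ∈ rightNucleus (PetitAlgebra f)) : x ∈ Set.range hc.embed := by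
  have hfx := hc.hom_eq_zero_of_mem_rightNucleus hf hx
  have hred : ∀ g, M.hom (toDiffPoly (red g : PetitAlgebra f)) (hc.val x) =
      M.hom g (hc.val x) := by
    intro g
    obtain ⟨q, hq⟩ := modR_spec hc.ne_zero g
    conv_rhs => rw [hq]
    rw [map_add, map_mul, LinearMap.add_apply, Module.End.mul_apply, hfx, map_zero, zero_add]
    rfl
  obtain ⟨b, hb⟩ := M.exists_eq_ρ_of_commute
    { toFun := fun w => M.hom (toDiffPoly (hc.val.symm w)) (hc.val x)
      map_zero' := by rw [map_zero, toDiffPoly_zero, map_zero, LinearMap.zero_apply]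
      map_add' := fun w w' => by rw [map_add, toDiffPoly_add, map_add, LinearMap.add_apply] }
    fun g w => by
      change M.hom (toDiffPoly (hc.val.symm (M.hom g w))) (hc.val x) =
        M.hom g (M.hom (toDiffPoly (hc.val.symm w)) (hc.val x))
      obtain ⟨y, rfl⟩ := hc.val.surjective w
      have h1 : hc.val.symm (M.hom g (hc.val y)) = red (g * toDiffPoly y) := by
        rw [LinearEquiv.symm_apply_eq, val_red, map_mul, Module.End.mul_apply, val_apply]
      rw [hc.val.symm_apply_apply, ← Module.End.mul_apply, ← map_mul, h1, hred]
  refine ⟨b, hc.val.injective ?_⟩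
  rw [val_embed, ← hb]
  change M.hom (toDiffPoly (hc.val.symm v)) (hc.val x) = hc.val x
  have h1 : hc.val.symm v = 1 := by rw [LinearEquiv.symm_apply_eq, val_one]
  rw [h1, ← val_mul, one_mul]

theorem rightNucleus_eq (hc : M.IsCyclic v f) (hf : 2 ≤ f.natDegree) :
    Set.range hc.embed = rightNucleus (PetitAlgebra f) :=
  Set.Subset.antisymm (by rintro _ ⟨b, rfl⟩; exact hc.embed_mem_rightNucleus b)
    fun _ hx => hc.mem_range_embed hf hx

/-- A nonconstant x pairs with the power of t of complementary degree. Were x in the left nucleus, f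
would kill zv for every z, that is, all of V. -/
theorem leftNucleus_eq (hc : M.IsCyclic v f) (hf : f.natDegree ≠ 0) (hhom : M.hom f ≠ 0) :
    leftNucleus (PetitAlgebra f) = Set.range (const f) := by
  refine Set.Subset.antisymm (fun x hx => ?_) ?_
  · refine exists_const_of_natDegree_eq_zero hf ?_
    by_contra hne
    have hlt := natDegree_toDiffPoly_lt hf x
    have hx0 : toDiffPoly x ≠ 0 := fun h0 => hne (by rw [h0]; exact Polynomial.natDegree_zero)
    have h1 := X_pow_facts (f := f) (i := f.natDegree - (toDiffPoly x).natDegree) (by omega)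
    refine hhom (LinearMap.ext fun w => ?_)
    obtain ⟨z, rfl⟩ := hc.val.surjective w
    exact hc.smul_hom_eq_zero hf hx0 h1.1 (by rw [h1.2]; omega) (hx _ _)
  · rintro _ ⟨a, rfl⟩
    exact const_mem_leftNucleus a

theorem middleNucleus_eq (hc : M.IsCyclic v f) (hf : f.natDegree ≠ 0) (hhom : M.hom f ≠ 0) :
    middleNucleus (PetitAlgebra f) = Set.range (const f) := by
  refine Set.Subset.antisymm (fun x hx => ?_) ?_
  · refine exists_const_of_natDegree_eq_zero hf ?_
    by_contra hne
    have hlt := natDegree_toDiffPoly_lt hf x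
    have hx0 : toDiffPoly x ≠ 0 := fun h0 => hne (by rw [h0]; exact Polynomial.natDegree_zero)
    have h1 := X_pow_facts (f := f) (i := f.natDegree - (toDiffPoly x).natDegree) (by omega)
    refine hhom (LinearMap.ext fun w => ?_)
    obtain ⟨z, rfl⟩ := hc.val.surjective w
    exact hc.smul_hom_eq_zero hf h1.1 hx0 (by rw [h1.2]; omega) (hx _ _)
  · rintro _ ⟨a, rfl⟩
    exact hc.const_mem_middleNucleus hf a

theorem nucleus_eq (hc : M.IsCyclic v f) (hf : 2 ≤ f.natDegree) (hhom : M.hom f ≠ 0) :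
    nucleus (PetitAlgebra f) = Set.range hc.embed ∩ Set.range (const f) := by
  rw [nucleus, hc.leftNucleus_eq (by omega) hhom, hc.middleNucleus_eq (by omega) hhom,
    Set.inter_self, hc.rightNucleus_eq hf, Set.inter_comm]

/-- The intermediate field `B ∩ K`. -/
noncomputable def interField [Algebra.IsAlgebraic F K] (hc : M.IsCyclic v f) :
    IntermediateField F K :=
  Subalgebra.toIntermediateField
    { carrier := {a | const f a ∈ Set.range hc.embed}
      mul_mem' := by
        rintro a b ⟨x, hx⟩ ⟨y, hy⟩
        exact ⟨x * y, by rw [map_mul, map_mul, hx, hy]⟩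
      add_mem' := by
        rintro a b ⟨x, hx⟩ ⟨y, hy⟩
        exact ⟨x + y, by rw [map_add, map_add, hx, hy]⟩
      algebraMap_mem' := fun c => ⟨c • 1, by
        rw [map_smul, embed_one]
        exact (algebraMap_smul K c (1 : PetitAlgebra f)).symm⟩ }
    fun _ hx => Subalgebra.inv_mem_of_algebraic _ (x := ⟨_, hx⟩) (Algebra.IsAlgebraic.isAlgebraic _)

theorem mem_interField (hc : M.IsCyclic v f) [Algebra.IsAlgebraic F K] {a : K} :
    a ∈ hc.interField ↔ const f a ∈ Set.range hc.embed := Iff.rfl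

/-- If every a in K lay in `B`, then f would kill av, so fa - af would kill v in degree below deg f
and vanish. An f of degree below N commuting with K is constant. -/
theorem interField_ne_top (hc : M.IsCyclic v f) [Algebra.IsAlgebraic F K] {N : ℕ}
    (hind : ∀ f : K[X], act δ.toLinearMap f = 0 → f.natDegree < N → f = 0)
    (hf : 2 ≤ f.natDegree) (hN : f.natDegree < N) : hc.interField ≠ ⊤ := by
  intro htop
  have h0 : f.natDegree = 0 := natDegree_eq_zero_of_commute hind hN fun a => by
    by_contra hne
    refine hne (hc.eq_zero _ ?_ (natDegree_commutator_lt hne))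
    have ha : a ∈ hc.interField := htop ▸ IntermediateField.mem_top
    rw [mem_interField, hc.rightNucleus_eq hf] at ha
    have h1 := hc.hom_eq_zero_of_mem_rightNucleus hf ha
    rw [val_const] at h1
    rw [map_sub, map_mul, LinearMap.sub_apply, Module.End.mul_apply, hom_C, h1, hom_smul,
      hc.hom_eq_zero, smul_zero, sub_zero]
  omega

theorem exists_interField (hc : M.IsCyclic v f) [Algebra.IsAlgebraic F K] {N : ℕ}
    (hind : ∀ f : K[X], act δ.toLinearMap f = 0 → f.natDegree < N → f = 0)
    (hf : 2 ≤ f.natDegree) (hN : f.natDegree < N) (hhom : M.hom f ≠ 0) :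
    ∃ L : IntermediateField F K, L ≠ ⊤ ∧ nucleus (PetitAlgebra f) = const f '' (L : Set K) := by
  refine ⟨hc.interField, hc.interField_ne_top hind hf hN, ?_⟩
  rw [hc.nucleus_eq hf hhom]
  ext x
  constructor
  · rintro ⟨hx, a, rfl⟩
    exact ⟨a, hx, rfl⟩
  · rintro ⟨a, ha, rfl⟩
    exact ⟨ha, a, rfl⟩

/-! ### Irreducibility -/

/-- The submodule generated by an element that is annihilated by a nonzero `x` of degree less than
`deg f` is proper. -/
theorem exists_forall_hom_ne {x : DiffPoly δ} (hx0 : x ≠ 0) (hx : x.natDegree < f.natDegree)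
    {w : V} (hxw : M.hom x w = 0) (hc : M.IsCyclic v f) : ∃ u, ∀ g, M.hom g w ≠ u := by
  by_contra! h
  -- Since x kills w, remainders modulo x already produce the whole submodule generated by w. Its
  -- K-dimension is at most deg x < deg f = dim V.
  let s : degreeLT K x.natDegree →ₗ[K] V :=
    { toFun := fun r => M.hom (ofPoly δ r) w
      map_add' := fun r r' => by
        change M.hom (ofPoly δ (r + r' : K[X])) w = _
        rw [ofPoly_add, map_add, LinearMap.add_apply]
      map_smul' := fun a r => M.hom_smul a (ofPoly δ r) w }
  have hs : Function.Surjective s := by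
    intro u
    obtain ⟨g, rfl⟩ := h u
    obtain ⟨q, r, hqr, hr⟩ := exists_eq_mul_add hx0 g
    refine ⟨⟨poly r, mem_degreeLT.mpr hr⟩, ?_⟩
    rw [hqr, map_add, map_mul, LinearMap.add_apply, Module.End.mul_apply, hxw, map_zero, zero_add]
    rfl
  have h1 := LinearMap.finrank_le_finrank_of_surjective hs
  rw [(degreeLTEquiv K _).finrank_eq, Module.finrank_fin_fun, ← hc.natDegree_eq] at h1
  omega

/-- The elements h for which hv lies in the submodule generated by w form a left ideal containing f,
and one of least degree divides f on the right. It is not a unit because the submodule is proper, so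
irreducibility gives it the degree of f. Writing w = yv with deg y < deg f then forces y = 0. -/
theorem eq_zero_of_irreducible (hirr : Irreducible f) {w u : V} (hu : ∀ g, M.hom g w ≠ u)
    (hc : M.IsCyclic v f) : w = 0 := by
  classical
  have hex : ∃ n, ∃ h : DiffPoly δ, h ≠ 0 ∧ (∃ g, M.hom g w = M.hom h v) ∧ h.natDegree = n :=
    ⟨_, f, hc.ne_zero, ⟨0, by rw [hc.hom_eq_zero, map_zero, LinearMap.zero_apply]⟩, rfl⟩
  obtain ⟨h, hh0, ⟨g, hg⟩, hhn⟩ := Nat.find_spec hex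
  have hmin : ∀ r : DiffPoly δ, (∃ g, M.hom g w = M.hom r v) → r.natDegree < h.natDegree →
      r = 0 := fun r hr hlt => by
    by_contra hr0
    exact Nat.find_min hex (hhn ▸ hlt) ⟨r, hr0, hr, rfl⟩
  have hh1 : h.natDegree ≠ 0 := by
    intro h1
    obtain ⟨k, hk⟩ := (isUnit_iff.mpr ⟨hh0, h1⟩).exists_left_inv
    obtain ⟨y, hy⟩ := hc.exists_eq u
    refine hu (y * (k * g)) ?_
    rw [map_mul, map_mul, Module.End.mul_apply, Module.End.mul_apply, hg, ← Module.End.mul_apply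
      (M.hom k), ← map_mul, hk, map_one, Module.End.one_apply, hy]
  obtain ⟨q, r, hqr, hr⟩ := exists_eq_mul_add hh0 f
  have hr0 : r = 0 := by
    by_contra hne
    refine hne (hmin r ⟨-(q * g), ?_⟩ ((natDegree_lt_iff_degree_lt hne).mpr hr))
    have h1 := hc.hom_eq_zero
    rw [hqr, map_add, map_mul, LinearMap.add_apply, Module.End.mul_apply] at h1
    rw [map_neg, map_mul, LinearMap.neg_apply, Module.End.mul_apply, hg,
      eq_neg_of_add_eq_zero_right h1]
  rw [hr0, add_zero] at hqr
  have hqu : IsUnit q :=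
      (hirr.isUnit_or_isUnit hqr).resolve_right fun hu => hh1 (isUnit_iff.mp hu).2
  have hq := isUnit_iff.mp hqu
  have hdeg : f.natDegree = h.natDegree := by
    rw [hqr, DiffPoly.natDegree_mul hq.1 hh0, hq.2, zero_add]
  have hf0 : f.natDegree ≠ 0 := hdeg ▸ hh1
  obtain ⟨y, rfl⟩ := hc.val.surjective w
  have hy : toDiffPoly y = 0 := hmin _ ⟨1, by rw [map_one]; rfl⟩
    (hdeg ▸ natDegree_toDiffPoly_lt hf0 y)
  rw [val_apply, hy, map_zero, LinearMap.zero_apply]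

/-- If x ∘ y = 0 with x ≠ 0, then x kills yv, so yv generates a proper submodule, which is zero by
irreducibility. -/
theorem isDivisionAlgebra_of_irreducible [FiniteDimensional F V] [Nontrivial V]
    (hirr : Irreducible f) (hc : M.IsCyclic v f) : IsDivisionAlgebra (PetitAlgebra f) := by
  have : FiniteDimensional F (PetitAlgebra f) :=
    (hc.val.restrictScalars F).symm.finiteDimensional
  have : Nontrivial (PetitAlgebra f) := hc.val.symm.injective.nontrivial
  have hf0 : f.natDegree ≠ 0 := fun h =>
    hirr.not_isUnit (isUnit_iff.mpr ⟨hc.ne_zero, h⟩)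
  refine isDivisionAlgebra_of_mul_eq_zero F fun x y hxy => ?_
  rw [or_iff_not_imp_left]
  intro hx
  have hx0 : toDiffPoly x ≠ 0 := fun h => hx (toDiffPoly_injective h)
  have h1 : M.hom (toDiffPoly x) (hc.val y) = 0 := by rw [← val_mul, hxy, map_zero]
  obtain ⟨u, hu⟩ := exists_forall_hom_ne hx0 (natDegree_toDiffPoly_lt hf0 x) h1 hc
  exact hc.val.injective ((eq_zero_of_irreducible hirr hu hc).trans (map_zero _).symm)

theorem isDivisionAlgebra_of_petit [FiniteDimensional F B] [Nontrivial B]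
    (h : IsDivisionAlgebra (PetitAlgebra f)) (hc : M.IsCyclic v f) : IsDivisionAlgebra B := by
  refine isDivisionAlgebra_of_mul_eq_zero F fun x y hxy => ?_
  have h1 : hc.embed x * hc.embed y = 0 := by rw [← map_mul, hxy, map_zero]
  rcases h.eq_zero_or_eq_zero h1 with h2 | h2
  · exact Or.inl (hc.embed_injective (h2.trans (map_zero _).symm))
  · exact Or.inr (hc.embed_injective (h2.trans (map_zero _).symm))

/-- A proper factorisation f = xy gives w = yv, nonzero by minimality of f and killed by x. It
generates a nonzero proper submodule, and projecting onto that submodule is an idempotent of `B`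
other than 0 and 1. -/
theorem irreducible_of_isDivisionAlgebra (h : IsDivisionAlgebra B) [FiniteDimensional F V]
    [Nontrivial V] {N : ℕ}
    (hind : ∀ f : K[X], act δ.toLinearMap f = 0 → f.natDegree < N → f = 0)
    (hN : N ≠ 0) {d : K} (hd : ∀ v, (M.T ^ N) v = d • v)
    (hf : f.natDegree ≠ 0) (hc : M.IsCyclic v f) : Irreducible f := by
  refine ⟨fun hu => hf (isUnit_iff.mp hu).2, fun x y hxy => ?_⟩
  by_contra! hne
  have hx0 : x ≠ 0 := by rintro rfl; exact hc.ne_zero (by rw [hxy, zero_mul])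
  have hy0 : y ≠ 0 := by rintro rfl; exact hc.ne_zero (by rw [hxy, mul_zero])
  have hdx : x.natDegree ≠ 0 := fun h => hne.1 (isUnit_iff.mpr ⟨hx0, h⟩)
  have hdy : y.natDegree ≠ 0 := fun h => hne.2 (isUnit_iff.mpr ⟨hy0, h⟩)
  have hdeg := DiffPoly.natDegree_mul hx0 hy0
  rw [← hxy] at hdeg
  set w := M.hom y v with hw
  have hw0 : w ≠ 0 := fun h => hy0 (hc.eq_zero y h (by omega))
  have hxw : M.hom x w = 0 := by
    rw [hw, ← Module.End.mul_apply, ← map_mul, ← hxy, hc.hom_eq_zero]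
  obtain ⟨u, hu⟩ := exists_forall_hom_ne hx0 (by omega) hxw hc
  let W : AddSubgroup V :=
    { carrier := {z | ∃ g, M.hom g w = z}
      add_mem' := by
        rintro _ _ ⟨g, rfl⟩ ⟨g', rfl⟩
        exact ⟨g + g', by rw [map_add, LinearMap.add_apply]⟩
      zero_mem' := ⟨0, by rw [map_zero, LinearMap.zero_apply]⟩
      neg_mem' := by
        rintro _ ⟨g, rfl⟩
        exact ⟨-g, by rw [map_neg, LinearMap.neg_apply]⟩ }
  obtain ⟨b, hb, hb'⟩ := M.exists_projection hind hN hd W (by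
    rintro g _ ⟨g', rfl⟩
    exact ⟨g * g', by rw [map_mul, Module.End.mul_apply]⟩)
  have hbw := hb' w ⟨1, by rw [map_one, Module.End.one_apply]⟩
  have hidem : b * (b - 1) = 0 := by
    rw [mul_sub, mul_one, sub_eq_zero]
    apply M.ρ_injective
    ext z
    rw [M.ρ_mul, Module.End.mul_apply, hb' _ (hb z)]
  rcases h.eq_zero_or_eq_zero hidem with h0 | h1
  · rw [h0, map_zero, LinearMap.zero_apply] at hbw
    exact hw0 hbw.symm
  · obtain ⟨g, hg⟩ := hb u
    rw [sub_eq_zero.mp h1, M.ρ_one, Module.End.one_apply] at hg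
    exact hu g hg

/-! ### Automorphisms -/

/-- A multiplicative bijection carries associators to associators, hence preserves the right
nucleus, which is `B`. -/
theorem exists_algEquiv_of_rightNucleus (hc : M.IsCyclic v f) (hf : 2 ≤ f.natDegree)
    (H : PetitAlgebra f ≃ₗ[F] PetitAlgebra f) (hH : ∀ x y, H (x * y) = H x * H y) :
    ∃ α : B ≃ₐ[F] B, ∀ x, H (hc.embed x) = hc.embed (α x) := by
  have hass : ∀ x y z, associator (H x) (H y) (H z) = H (associator x y z) := by
    intro x y z
    simp only [associator, map_sub, hH]
  have hmem : ∀ x, H x ∈ rightNucleus (PetitAlgebra f) ↔ x ∈ rightNucleus (PetitAlgebra f) := by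
    intro x
    constructor
    · intro h y z
      rw [← map_eq_zero_iff H H.injective, ← hass]
      exact h _ _
    · intro h y z
      obtain ⟨y, rfl⟩ := H.surjective y
      obtain ⟨z, rfl⟩ := H.surjective z
      rw [hass, h, map_zero]
  have h1 : ∀ x, ∃ y, hc.embed y = H (hc.embed x) := fun x =>
    hc.mem_range_embed hf ((hmem _).mpr (hc.embed_mem_rightNucleus x))
  choose α hα using h1
  have hinj : Function.Injective α := fun x y h =>
    hc.embed_injective (H.injective (by rw [← hα, ← hα, h]))
  have hsurj : Function.Surjective α := by
    intro y
    obtain ⟨z, hz⟩ := H.surjective (hc.embed y)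
    obtain ⟨x, rfl⟩ := hc.mem_range_embed hf ((hmem z).mp (hz ▸ hc.embed_mem_rightNucleus y))
    exact ⟨x, hc.embed_injective (by rw [hα, hz])⟩
  have hlin : ∀ (c : F) x, α (c • x) = c • α x := fun c x =>
    hc.embed_injective (by rw [hα, map_smul, map_smul, map_smul, hα])
  have hmul : ∀ x y, α (x * y) = α x * α y := fun x y =>
    hc.embed_injective (by rw [hα, map_mul, hH, map_mul, hα, hα])
  have hone : α 1 = 1 := by
    obtain ⟨x, hx⟩ := hsurj 1
    have h := hmul x 1
    rwa [mul_one, hx, one_mul, eq_comm] at h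
  let A : B →ₐ[F] B := AlgHom.ofLinearMap
    { toFun := α
      map_add' := fun x y => hc.embed_injective (by rw [hα, map_add, map_add, map_add, hα, hα])
      map_smul' := hlin } hone hmul
  exact ⟨AlgEquiv.ofBijective A ⟨hinj, hsurj⟩, fun x => (hα x).symm⟩

theorem exists_algEquiv_of_leftNucleus (hf : f.natDegree ≠ 0) (hhom : M.hom f ≠ 0)
    [FiniteDimensional F K] (hc : M.IsCyclic v f)
    (H : PetitAlgebra f ≃ₗ[F] PetitAlgebra f) (hH : ∀ x y, H (x * y) = H x * H y) :
    ∃ σ : K ≃ₐ[F] K, ∀ a, H (const f a) = const f (σ a) := by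
  have hass : ∀ x y z, associator (H x) (H y) (H z) = H (associator x y z) := by
    intro x y z
    simp only [associator, map_sub, hH]
  have h1 : ∀ a, ∃ b, const f b = H (const f a) := by
    intro a
    change H (const f a) ∈ Set.range (const f)
    rw [← hc.leftNucleus_eq hf hhom]
    intro y z
    obtain ⟨y, rfl⟩ := H.surjective y
    obtain ⟨z, rfl⟩ := H.surjective z
    rw [hass, const_mem_leftNucleus a y z, map_zero]
  choose σ hσ using h1
  have hci := const_injective hf
  have hsmul : ∀ (c : F) a, const f (c • a) = c • const f a := fun c a => smul_assoc c a _
  -- Unitality is not assumed: it follows by applying `H` to x = x1, where x is a preimage of 1.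
  have hone : H 1 = 1 := by
    obtain ⟨x, hx⟩ := H.surjective 1
    have := hH x 1
    rw [mul_one, hx, one_mul] at this
    exact this.symm
  let A : K →ₐ[F] K := AlgHom.ofLinearMap
    { toFun := σ
      map_add' := fun x y => hci (by rw [hσ, map_add, map_add, map_add, hσ, hσ])
      map_smul' := fun c x => hci (by rw [hσ, hsmul, map_smul, RingHom.id_apply, hsmul, hσ]) }
    (hci (by change const f (σ 1) = _; rw [hσ, map_one, hone]))
    (fun x y => hci (by
      change const f (σ (x * y)) = const f (σ x * σ y)
      rw [hσ, map_mul, hH, map_mul, hσ, hσ]))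
  have hA : Function.Bijective A :=
    ⟨A.toRingHom.injective, (LinearMap.injective_iff_surjective (f := A.toLinearMap)).mp
      A.toRingHom.injective⟩
  exact ⟨AlgEquiv.ofBijective A hA, fun x => (hσ x).symm⟩

end IsCyclic

end

end DiffBimodule

/-! ### Assembly of the theorem. -/

theorem mainTheorem4 {p e m : ℕ} [Fact p.Prime]
    {F : Type u} {K : Type v} {B : Type w}
    [Field F] [CharP F p] [Field K] [Algebra F K]
    [IsPurelyInseparable.HasExponent F K] (hexp : IsPurelyInseparable.exponent F K = 1)
    (hK : Module.finrank F K = p ^ e)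
    [Ring B] [Algebra F B] (hB : IsPAlgebra p F B m) (hsplit : IsSplitBy F B K)
    (hm : 2 ≤ m) (hme : m < p ^ e) :
    ∃ (δ : Derivation F K K) (f : DiffPoly δ) (φ : B →ₙₐ[F] PetitAlgebra f),
      IsAlgebraicDerivation p e δ ∧ f.natDegree = m ∧
      -- dimension and nuclei
      Module.finrank F (PetitAlgebra f) = m * p ^ e ∧
      (φ 1 = 1 ∧ Function.Injective φ ∧ Set.range φ = rightNucleus (PetitAlgebra f)) ∧
      leftNucleus (PetitAlgebra f) = Set.range (PetitAlgebra.const f) ∧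
      middleNucleus (PetitAlgebra f) = Set.range (PetitAlgebra.const f) ∧
      nucleus (PetitAlgebra f) = Set.range φ ∩ Set.range (PetitAlgebra.const f) ∧
      (∃ L : IntermediateField F K, L ≠ ⊤ ∧
        nucleus (PetitAlgebra f) = PetitAlgebra.const f '' (L : Set K)) ∧
      -- irreducibility
      (Irreducible f ↔ IsDivisionAlgebra B) ∧
      (IsDivisionAlgebra B ↔ IsDivisionAlgebra (PetitAlgebra f)) ∧
      -- automorphisms
      ∀ H : PetitAlgebra f ≃ₗ[F] PetitAlgebra f, (∀ x y, H (x * y) = H x * H y) →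
        (∃ b : Bˣ, ∀ x : B, H (φ x) = φ (b * x * (b⁻¹ : Bˣ))) ∧
        (∃ σ : K ≃ₐ[F] K, ∀ a : K, H (PetitAlgebra.const f a) = PetitAlgebra.const f (σ a)) := by
  have hp : p.Prime := Fact.out
  have hKpos : 0 < Module.finrank F K := by rw [hK]; exact pow_pos hp.pos e
  have : FiniteDimensional F K := Module.finite_of_finrank_pos hKpos
  have := hB.isCentral
  have := hB.isSimple
  have hBpos : 0 < Module.finrank F B := by rw [hB.finrank_eq.2]; exact pow_pos hB.finrank_eq.1 2
  have : FiniteDimensional F B := Module.finite_of_finrank_pos hBpos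
  have : NeZero m := ⟨by omega⟩
  have hN : p ^ e ≠ 0 := (pow_pos hp.pos e).ne'
  have : ExpChar F p := ExpChar.prime hp
  obtain ⟨δ, hδ, hnil⟩ := Derivation.exists_nilpotent_constants (F := F) (K := K) (p := p)
    fun x => by
      have h := IsPurelyInseparable.exponent_def' F p x
      rwa [hexp, pow_one] at h
  have hmin := Derivation.minpoly_eq_X_pow δ hδ hnil
  rw [hK] at hmin
  have hpow : (δ.toLinearMap : Module.End F K) ^ p ^ e = 0 := by
    have h := minpoly.aeval F (δ.toLinearMap : Module.End F K)
    rwa [hmin, map_pow, aeval_X] at h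
  have hind : ∀ f : K[X], DiffPoly.act (δ.toLinearMap : Module.End F K) f = 0 →
      f.natDegree < p ^ e → f = 0 := fun f h1 h2 =>
    Derivation.eq_zero_of_act_eq_zero δ hδ hnil f h1 (by rwa [hK])
  obtain ⟨M⟩ := hsplit.exists_diffBimodule hδ hB.finrank_eq.2
  have hV : Module.finrank K (Fin m → K) = m := Module.finrank_fin_fun K
  obtain ⟨d, hd⟩ := M.exists_pow_char_eq hpow
  obtain ⟨v, hv⟩ := M.exists_cyclic hind hN hd (hV.trans_le hme.le)
  obtain ⟨f, hc⟩ := M.exists_isCyclic hv hN hd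
  have hfm : f.natDegree = m := hc.natDegree_eq.trans hV
  have hf2 : 2 ≤ f.natDegree := hfm ▸ hm
  have hf0 : f.natDegree ≠ 0 := by omega
  have hfN : f.natDegree < p ^ e := hfm ▸ hme
  -- The strict inequality m < p^e enters here: f kills v but not all of V.
  have hhom : M.hom f ≠ 0 := fun h => hc.ne_zero (M.eq_zero_of_hom_eq_zero hind h hfN)
  -- The equivalences are closed in a cycle: f irreducible, S_f division, `B` division, f
  -- irreducible.
  have hirr : Irreducible f → IsDivisionAlgebra (PetitAlgebra f) := fun h =>
    DiffBimodule.IsCyclic.isDivisionAlgebra_of_irreducible h hc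
  have hdiv : IsDivisionAlgebra (PetitAlgebra f) → IsDivisionAlgebra B := fun h =>
    DiffBimodule.IsCyclic.isDivisionAlgebra_of_petit h hc
  have hdivB : IsDivisionAlgebra B → Irreducible f := fun h =>
    DiffBimodule.IsCyclic.irreducible_of_isDivisionAlgebra h hind hN hd hf0 hc
  -- The minimal polynomial is X^(p^e), so all the coefficients c_i are zero.
  refine ⟨δ, f, hc.embed, ⟨hδ, 0, by simp [hmin]⟩, hfm, ?_,
    ⟨hc.embed_one, hc.embed_injective, hc.rightNucleus_eq hf2⟩, hc.leftNucleus_eq hf0 hhom,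
    hc.middleNucleus_eq hf0 hhom, hc.nucleus_eq hf2 hhom, hc.exists_interField hind hf2 hfN hhom,
    ⟨fun h => hdiv (hirr h), hdivB⟩, ⟨fun h => hirr (hdivB h), hdiv⟩, fun H hH => ⟨?_, ?_⟩⟩
  · rw [(hc.val.restrictScalars F).finrank_eq, ← Module.finrank_mul_finrank F K, hK, hV, mul_comm]
  · obtain ⟨α, hα⟩ := hc.exists_algEquiv_of_rightNucleus hf2 H hH
    obtain ⟨b, hb⟩ := hsplit.exists_eq_conj hB.finrank_eq.2 α
    exact ⟨b, fun x => by rw [hα, hb]⟩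
  · exact DiffBimodule.IsCyclic.exists_algEquiv_of_leftNucleus hf0 hhom hc H hH
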